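/- Conventions. An $\omega$-category is a set $C$ with unary operators $d^-_n,d^+_n$ $(n\ge 0)$ and partial binary compositions $\#_n$ $(n\ge 0)$ satisfying the usual axioms of strict $\omega$-categories: $x\#_n y$ is defined iff $d^+_nx=d^-_ny$; for every $x$ there is $n$ with $d^-_nx=d^+_nx=x$; $d^\beta_md^\alpha_n=d^\beta_m$ for $m<n$ and $d^\beta_md^\alpha_n=d^\alpha_n$ for $m\ge n$; $d^-_nx\#_nx=x=x\#_nd^+_nx$; if $x\#_ny$ is defined, then $d^\alpha_m(x\#_ny)=d^\alpha_mx=d^\alpha_my=d^\alpha_mx\#_nd^\alpha_my$ for $m<n$, $d^-_n(x\#_ny)=d^-_nx$, $d^+_n(x\#_ny)=d^+_ny$, and $d^\alpha_m(x\#_ny)=d^\alpha_mx\#_nd^\alpha_my$ for $m>n$; each $\#_n$ is associative; and $(x\#_ny)\#_m(x'\#_ny')=(x\#_mx')\#_n(y\#_my')$ for $m<n$ whenever the left side is defined. Morphisms are the functions commuting with all these operators. Put $C_n=\{x\in C: d^-_nx=x\}$. A subset $E\subseteq C$, each of whose elements $e$ is assigned a dimension $|e|\in\mathbb N$, *composition-generates*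 $C$ if, for every $n\ge 0$, $C_n$ is exactly the set of elements obtained from $\{e\in E:|e|\le n\}$ by finitely many compositions $\#_m$ (without use of the operators $d^\alpha_m$). An augmented directed complex $K$ is an augmented chain complex $(K_n,\partial,\varepsilon)$ of abelian groups in dimensions $n\ge 0$, with augmentation $\varepsilon\colon K_0\to\mathbb Z$ and a submonoid $K_n^*\subseteq K_n$ for every $n$. Let $\mu K$ be the abelian group of double sequences $x=(x_n^-,x_n^+)_{n\ge0}$ with $x^\pm_n\in K_n$, almost all zero, and $x_n^+-x_n^-=\partial x_{n+1}^-=\partial x_{n+1}^+$ for all $n$. It is an $\omega$-category with $d^\alpha_nx=(x_0^-,x_0^+,\dots,x_{n-1}^-,x_{n-1}^+,x_n^\alpha,x_n^\alpha,0,0,\dots)$ and $x\#_ny=x-z+y$ when $d^+_nx=d^-_ny=z$. Let $\nu K$ be its sub-$\omega$-category of all $x$ with $x_n^\pm\in K_n^*$ for all $n$ and $\varepsilon x_0^-=\varepsilon x_0^+=1$. A *basis* of $K$ is a set $B\subseteq\bigsqcup_nK_n$ such that, for every $n$, $K_n$ is free abelian on $B\cap K_n$ and $K_n^*$ is the submonoid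 generated by $B\cap K_n$. Then $K_n$ is a lattice under $x\le y\iff y-x\in K_n^*$. For $x\in K_{n+1}$ let $\partial^+x,\partial^-x\in K_n$ be the positive and negative parts of $\partial x$, so that $\partial x=\partial^+x-\partial^-x$ and $\partial^+x\wedge\partial^-x=0$. For $b\in B\cap K_p$ put $|b|=p$; the *atom* $\langle b\rangle\in\mu K$, of dimension $p$, is given by $\langle b\rangle^\alpha_n=0$ for $n>p$, $\langle b\rangle_p^\alpha=b$, and $\langle b\rangle_n^\alpha=\partial^\alpha\langle b\rangle_{n+1}^\alpha$ for $n<p$. The basis is *unital* if $\varepsilon\langle b\rangle_0^-=\varepsilon\langle b\rangle_0^+=1$ for every $b\in B$ (so that all atoms lie in $\nu K$). It is *loop-free* if there are partial orderings $\le_0,\le_1,\dots$ on $B$ such that $a<_nb$ whenever $|a|,|b|>n$ and $\langle a\rangle_n^+\wedge\langle b\rangle_n^->0$. **Theorem.** Let $C$ be an $\omega$-category composition-generated by a set $E$, let $K$ be an augmented directed complex with a loop-free unital basis, and let $\theta\colon C\to\nu K$ be a morphism which restricts to a dimension-preserving bijection from $E$ onto the set of atoms of $\nu K$. Then $\theta$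 is an isomorphism of $\omega$-categories. -/

import Mathlib

universe u v w

namespace Steiner

/-! ### Strict omega-categories -/

/-- The two signs labelling sources (`minus`) and targets (`plus`). -/
inductive Side
  | minus
  | plus

/-- A (strict, single-set) `ω`-category structure on `C`: unary operators `d^α_n` and, for each `n`,
a partial binary operation `x #_n y` defined exactly when `d^+_n x = d^-_n y`.  The statements
`∃ h, … comp n x y h …` say that the composite in question is defined and satisfies the equation. -/
class OmegaCategory (C : Type u) where
  /-- the source and target operators -/
  d : Side → ℕ → C → C
  /-- the composite `x #_n y` -/
  comp : (n : ℕ) → (x y : C) → d .plus n x = d .minus n y → C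
  exists_dim : ∀ x, ∃ n, d .minus n x = x ∧ d .plus n x = x
  d_d_of_lt : ∀ (α β : Side) (m n : ℕ) (x : C), m < n → d β m (d α n x) = d β m x
  d_d_of_ge : ∀ (α β : Side) (m n : ℕ) (x : C), n ≤ m → d β m (d α n x) = d α n x
  id_comp : ∀ (n : ℕ) (x : C), ∃ h, comp n (d .minus n x) x h = x
  comp_id : ∀ (n : ℕ) (x : C), ∃ h, comp n x (d .plus n x) h = x
  d_comp_of_lt : ∀ (α : Side) (m n : ℕ) (x y : C) (h : d .plus n x = d .minus n y), m < n →
    d α m (comp n x y h) = d α m x ∧ d α m x = d α m y ∧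
      ∃ h', d α m (comp n x y h) = comp n (d α m x) (d α m y) h'
  d_minus_comp : ∀ (n : ℕ) (x y : C) (h : d .plus n x = d .minus n y),
    d .minus n (comp n x y h) = d .minus n x
  d_plus_comp : ∀ (n : ℕ) (x y : C) (h : d .plus n x = d .minus n y),
    d .plus n (comp n x y h) = d .plus n y
  d_comp_of_gt : ∀ (α : Side) (m n : ℕ) (x y : C) (h : d .plus n x = d .minus n y), n < m →
    ∃ h', d α m (comp n x y h) = comp n (d α m x) (d α m y) h'
  /-- associativity, if the left side is defined -/
  assoc_left : ∀ (n : ℕ) (x y z : C) (h₁ : d .plus n x = d .minus n y)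
    (h₂ : d .plus n (comp n x y h₁) = d .minus n z),
    ∃ h₃ h₄, comp n (comp n x y h₁) z h₂ = comp n x (comp n y z h₃) h₄
  /-- associativity, if the right side is defined -/
  assoc_right : ∀ (n : ℕ) (x y z : C) (h₃ : d .plus n y = d .minus n z)
    (h₄ : d .plus n x = d .minus n (comp n y z h₃)),
    ∃ h₁ h₂, comp n (comp n x y h₁) z h₂ = comp n x (comp n y z h₃) h₄
  interchange : ∀ (m n : ℕ) (x y x' y' : C) (h₁ : d .plus n x = d .minus n y)
    (h₂ : d .plus n x' = d .minus n y')
    (h₃ : d .plus m (comp n x y h₁) = d .minus m (comp n x' y' h₂)), m < n →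
    ∃ h₄ h₅ h₆, comp m (comp n x y h₁) (comp n x' y' h₂) h₃ =
      comp n (comp m x x' h₄) (comp m y y' h₅) h₆

namespace OmegaCategory

variable {C : Type u} [OmegaCategory C]

/-- The set `C_n` of elements `x` with `d^-_n x = x` (equivalently `d^+_n x = x`). -/
def stratum (C : Type u) [OmegaCategory C] (n : ℕ) : Set C := {x | d .minus n x = x}

/-- The elements obtained from members of `S` by finitely many compositions `#_m`
(no use of the operators `d^α_m`). -/
inductive IsComposite (S : Set C) : C → Prop
  | base (x : C) (hx : x ∈ S) : IsComposite S x
  | comp (m : ℕ) (x y : C) (h : d .plus m x = d .minus m y)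
      (hx : IsComposite S x) (hy : IsComposite S y) : IsComposite S (OmegaCategory.comp m x y h)

/-- `C` is composition-generated by the set `E` with assigned dimensions `dim`: for every `n`, the
sub-`ω`-category `C_n` is generated under the compositions by the `e ∈ E` of dimension `≤ n`. -/
def CompositionGenerated (E : Set C) (dim : E → ℕ) : Prop :=
  ∀ n : ℕ, stratum C n = {x | IsComposite {e : C | ∃ he : e ∈ E, dim ⟨e, he⟩ ≤ n} x}

/-- A subset closed under all operations is an `ω`-category. -/
abbrev sub (S : Set C) (hd : ∀ α n x, x ∈ S → d α n x ∈ S)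
    (hc : ∀ n x y h, x ∈ S → y ∈ S → comp n x y h ∈ S) : OmegaCategory S where
  d α n x := ⟨d α n x.1, hd α n _ x.2⟩
  comp n x y h := ⟨comp n x.1 y.1 (congrArg Subtype.val h), hc _ _ _ _ x.2 y.2⟩
  exists_dim x := by
    obtain ⟨n, h₁, h₂⟩ := exists_dim x.1
    exact ⟨n, Subtype.ext h₁, Subtype.ext h₂⟩
  d_d_of_lt α β m n x h := Subtype.ext (d_d_of_lt α β m n x.1 h)
  d_d_of_ge α β m n x h := Subtype.ext (d_d_of_ge α β m n x.1 h)
  id_comp n x := by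
    obtain ⟨h, e⟩ := id_comp n x.1
    exact ⟨Subtype.ext h, Subtype.ext e⟩
  comp_id n x := by
    obtain ⟨h, e⟩ := comp_id n x.1
    exact ⟨Subtype.ext h, Subtype.ext e⟩
  d_comp_of_lt α m n x y h hmn := by
    obtain ⟨h₁, h₂, h₃, h₄⟩ := d_comp_of_lt α m n x.1 y.1 (congrArg Subtype.val h) hmn
    exact ⟨Subtype.ext h₁, Subtype.ext h₂, Subtype.ext h₃, Subtype.ext h₄⟩
  d_minus_comp n x y h := Subtype.ext (d_minus_comp n x.1 y.1 (congrArg Subtype.val h))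
  d_plus_comp n x y h := Subtype.ext (d_plus_comp n x.1 y.1 (congrArg Subtype.val h))
  d_comp_of_gt α m n x y h hmn := by
    obtain ⟨h₁, h₂⟩ := d_comp_of_gt α m n x.1 y.1 (congrArg Subtype.val h) hmn
    exact ⟨Subtype.ext h₁, Subtype.ext h₂⟩
  assoc_left n x y z h₁ h₂ := by
    obtain ⟨h₃, h₄, e⟩ := assoc_left n x.1 y.1 z.1 (congrArg Subtype.val h₁)
      (congrArg Subtype.val h₂)
    exact ⟨Subtype.ext h₃, Subtype.ext h₄, Subtype.ext e⟩
  assoc_right n x y z h₁ h₂ := by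
    obtain ⟨h₃, h₄, e⟩ := assoc_right n x.1 y.1 z.1 (congrArg Subtype.val h₁)
      (congrArg Subtype.val h₂)
    exact ⟨Subtype.ext h₃, Subtype.ext h₄, Subtype.ext e⟩
  interchange m n x y x' y' h₁ h₂ h₃ hmn := by
    obtain ⟨h₄, h₅, h₆, e⟩ := interchange m n x.1 y.1 x'.1 y'.1 (congrArg Subtype.val h₁)
      (congrArg Subtype.val h₂) (congrArg Subtype.val h₃) hmn
    exact ⟨Subtype.ext h₄, Subtype.ext h₅, Subtype.ext h₆, Subtype.ext e⟩

end OmegaCategory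

/-- A morphism of `ω`-categories: a function commuting with all operators. -/
structure OmegaHom (C : Type u) (D : Type w) [OmegaCategory C] [OmegaCategory D] where
  /-- the underlying function -/
  toFun : C → D
  map_d : ∀ (α : Side) (n : ℕ) (x : C),
    toFun (OmegaCategory.d α n x) = OmegaCategory.d α n (toFun x)
  map_comp : ∀ (n : ℕ) (x y : C) (h : OmegaCategory.d .plus n x = OmegaCategory.d .minus n y),
    toFun (OmegaCategory.comp n x y h) =
      OmegaCategory.comp n (toFun x) (toFun y)
        ((map_d .plus n x).symm.trans ((congrArg toFun h).trans (map_d .minus n y)))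

/-- A morphism is an isomorphism if it has a two-sided inverse morphism. -/
def OmegaHom.IsIso {C : Type u} {D : Type w} [OmegaCategory C] [OmegaCategory D]
    (f : OmegaHom C D) : Prop :=
  ∃ g : OmegaHom D C, (∀ x, g.toFun (f.toFun x) = x) ∧ ∀ y, f.toFun (g.toFun y) = y

/-! ### Augmented directed complexes -/

/-- An augmented directed complex: an augmented chain complex of abelian groups in nonnegative
dimensions with a distinguished submonoid of each chain group. -/
structure AugDirComplex where
  /-- the chain groups -/
  X : ℕ → Type v
  [grp : ∀ n, AddCommGroup (X n)]
  /-- the boundary -/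
  bd : ∀ n, X (n + 1) →+ X n
  /-- the augmentation -/
  aug : X 0 →+ ℤ
  bd_bd : ∀ n x, bd n (bd (n + 1) x) = 0
  aug_bd : ∀ x, aug (bd 0 x) = 0
  /-- the distinguished submonoids -/
  star : ∀ n, AddSubmonoid (X n)

attribute [instance] AugDirComplex.grp

namespace AugDirComplex

variable (K : AugDirComplex.{v})

/-- The abelian group `μK` of double sequences `(x^α_n)` of chains, almost all zero, such that
`x^+_n - x^-_n = ∂ x^-_{n+1} = ∂ x^+_{n+1}`. -/
def mu : AddSubgroup (∀ (_ : Side) (n : ℕ), K.X n) where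
  carrier := {x | (∃ N, ∀ n, N ≤ n → ∀ α, x α n = 0) ∧
    ∀ α n, x .plus n - x .minus n = K.bd n (x α (n + 1))}
  zero_mem' := ⟨⟨0, fun _ _ _ => rfl⟩, fun α n => by simp⟩
  add_mem' := by
    rintro x y ⟨⟨N, hN⟩, hx⟩ ⟨⟨M, hM⟩, hy⟩
    refine ⟨⟨max N M, fun n hn α => ?_⟩, fun α n => ?_⟩
    · simp [hN n (le_trans (le_max_left _ _) hn), hM n (le_trans (le_max_right _ _) hn)]
    · simp only [Pi.add_apply, map_add, ← hx, ← hy]; abel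
  neg_mem' := by
    rintro x ⟨⟨N, hN⟩, hx⟩
    refine ⟨⟨N, fun n hn α => by simp [hN n hn]⟩, fun α n => ?_⟩
    simp only [Pi.neg_apply, map_neg, ← hx]; abel

variable {K}

/-- `d^α_n x = (x^-_0, x^+_0, …, x^-_{n-1}, x^+_{n-1}, x^α_n, x^α_n, 0, 0, …)`. -/
def mu.d (α : Side) (n : ℕ) (x : K.mu) : K.mu :=
  ⟨fun β m => if m < n then x.1 β m else if m = n then x.1 α m else 0, by
    refine ⟨⟨n + 1, fun m hm β => ?_⟩, fun β m => ?_⟩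
    · show (if m < n then x.1 β m else if m = n then x.1 α m else 0) = 0
      rw [if_neg (by omega), if_neg (by omega)]
    · rcases lt_trichotomy (m + 1) n with h | h | h
      · simp only [if_pos h, if_pos (show m < n by omega)]
        exact x.2.2 β m
      · simp only [if_neg (show ¬ m + 1 < n by omega), if_pos h, if_pos (show m < n by omega)]
        exact x.2.2 α m
      · simp only [if_neg (show ¬ m + 1 < n by omega), if_neg (show ¬ m + 1 = n by omega),
          if_neg (show ¬ m < n by omega)]
        simp⟩

theorem mu.d_apply (α : Side) (n : ℕ) (x : K.mu) (β : Side) (m : ℕ) :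
    (mu.d α n x).1 β m = if m < n then x.1 β m else if m = n then x.1 α m else 0 := rfl

theorem mu.d_add (α : Side) (n : ℕ) (x y : K.mu) :
    mu.d α n (x + y) = mu.d α n x + mu.d α n y := by
  ext β m
  simp only [mu.d_apply, AddSubgroup.coe_add, Pi.add_apply]
  split_ifs <;> simp

theorem mu.d_sub (α : Side) (n : ℕ) (x y : K.mu) :
    mu.d α n (x - y) = mu.d α n x - mu.d α n y := by
  ext β m
  simp only [mu.d_apply, AddSubgroup.coe_sub, Pi.sub_apply]
  split_ifs <;> simp

theorem mu.d_d_of_lt (α β : Side) (m n : ℕ) (x : K.mu) (h : m < n) :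
    mu.d β m (mu.d α n x) = mu.d β m x := by
  ext γ k
  simp only [mu.d_apply]
  split_ifs <;> first | rfl | omega

theorem mu.d_d_of_ge (α β : Side) (m n : ℕ) (x : K.mu) (h : n ≤ m) :
    mu.d β m (mu.d α n x) = mu.d α n x := by
  ext γ k
  simp only [mu.d_apply]
  split_ifs <;> first | rfl | omega

/-- If `d^+_n x = d^-_n y = z` then `x #_n y = x - z + y`. -/
instance mu.omegaCategory : OmegaCategory K.mu where
  d := mu.d
  comp n x y _ := x - mu.d .plus n x + y
  exists_dim x := by
    obtain ⟨⟨N, hN⟩, hx⟩ := x.2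
    refine ⟨N, ?_, ?_⟩ <;>
    · ext β m
      rw [mu.d_apply]
      split_ifs with h₁ h₂
      · rfl
      · rw [hN m (by omega), hN m (by omega)]
      · rw [hN m (by omega)]
  d_d_of_lt := mu.d_d_of_lt
  d_d_of_ge := mu.d_d_of_ge
  id_comp n x := ⟨mu.d_d_of_ge _ _ _ _ _ le_rfl, by rw [mu.d_d_of_ge _ _ _ _ _ le_rfl]; abel⟩
  comp_id n x := ⟨(mu.d_d_of_ge _ _ _ _ _ le_rfl).symm, by abel⟩
  d_comp_of_lt α m n x y h hmn := by
    have e : mu.d α m x = mu.d α m y := by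
      rw [← mu.d_d_of_lt .plus α m n x hmn, h, mu.d_d_of_lt _ _ _ _ _ hmn]
    have e' : mu.d α m (x - mu.d .plus n x + y) = mu.d α m x := by
      rw [mu.d_add, mu.d_sub, mu.d_d_of_lt _ _ _ _ _ hmn, e]; abel
    refine ⟨e', e, ?_, ?_⟩
    · rw [mu.d_d_of_ge _ _ _ _ _ hmn.le, mu.d_d_of_ge _ _ _ _ _ hmn.le, e]
    · rw [e', mu.d_d_of_ge _ _ _ _ _ hmn.le, e]; abel
  d_minus_comp n x y h := by
    rw [mu.d_add, mu.d_sub, mu.d_d_of_ge _ _ _ _ _ le_rfl, h]; abel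
  d_plus_comp n x y h := by
    rw [mu.d_add, mu.d_sub, mu.d_d_of_ge _ _ _ _ _ le_rfl]; abel
  d_comp_of_gt α m n x y h hmn := by
    refine ⟨?_, ?_⟩
    · rw [mu.d_d_of_lt _ _ _ _ _ hmn, mu.d_d_of_lt _ _ _ _ _ hmn, h]
    · rw [mu.d_add, mu.d_sub, mu.d_d_of_ge _ _ _ _ _ hmn.le, mu.d_d_of_lt _ _ _ _ _ hmn]
  assoc_left n x y z h₁ h₂ := by
    have e : mu.d .plus n (x - mu.d .plus n x + y) = mu.d .plus n y := by
      rw [mu.d_add, mu.d_sub, mu.d_d_of_ge _ _ _ _ _ le_rfl]; abel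
    have h₃ : mu.d .plus n y = mu.d .minus n z := e.symm.trans h₂
    refine ⟨h₃, ?_, ?_⟩
    · rw [mu.d_add, mu.d_sub, mu.d_d_of_ge _ _ _ _ _ le_rfl, h₁, h₃]; abel
    · rw [e]; abel
  assoc_right n x y z h₃ h₄ := by
    have e : mu.d .minus n (y - mu.d .plus n y + z) = mu.d .minus n y := by
      rw [mu.d_add, mu.d_sub, mu.d_d_of_ge _ _ _ _ _ le_rfl, h₃]; abel
    have h₁ : mu.d .plus n x = mu.d .minus n y := h₄.trans e
    have e' : mu.d .plus n (x - mu.d .plus n x + y) = mu.d .plus n y := by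
      rw [mu.d_add, mu.d_sub, mu.d_d_of_ge _ _ _ _ _ le_rfl]; abel
    refine ⟨h₁, e'.trans h₃, ?_⟩
    rw [e']; abel
  interchange m n x y x' y' h₁ h₂ h₃ hmn := by
    have key : ∀ (α : Side) (a b : K.mu), mu.d .plus n a = mu.d .minus n b →
        mu.d α m a = mu.d α m b := fun α a b h => by
      rw [← mu.d_d_of_lt .plus α m n a hmn, h, mu.d_d_of_lt _ _ _ _ _ hmn]
    have key' : ∀ (α : Side) (a b : K.mu), mu.d .plus n a = mu.d .minus n b →
        mu.d α m (a - mu.d .plus n a + b) = mu.d α m b := fun α a b h => by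
      rw [mu.d_add, mu.d_sub, mu.d_d_of_lt _ _ _ _ _ hmn]; abel
    have h₅ : mu.d .plus m y = mu.d .minus m y' := by
      rw [← key' _ _ _ h₁, ← key' _ _ _ h₂]; exact h₃
    have h₄ : mu.d .plus m x = mu.d .minus m x' := by
      rw [key _ _ _ h₁, h₅, key _ _ _ h₂]
    refine ⟨h₄, h₅, ?_, ?_⟩
    · rw [mu.d_add, mu.d_sub, mu.d_add, mu.d_sub, mu.d_d_of_ge _ _ _ _ _ hmn.le,
        mu.d_d_of_ge _ _ _ _ _ hmn.le, h₁, h₂, key _ _ _ h₁]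
    · rw [key' _ _ _ h₁, mu.d_add, mu.d_sub, mu.d_d_of_ge _ _ _ _ _ hmn.le]
      abel

variable (K) in
/-- The subset `νK` of `μK`: all `x^α_n` lie in the distinguished submonoids and
`ε x^-_0 = ε x^+_0 = 1`. -/
def nu : Set K.mu := {x | (∀ α n, x.1 α n ∈ K.star n) ∧ ∀ α, K.aug (x.1 α 0) = 1}

theorem nu_d_mem (α : Side) (n : ℕ) (x : K.mu) (hx : x ∈ K.nu) : mu.d α n x ∈ K.nu := by
  refine ⟨fun β m => ?_, fun β => ?_⟩
  · rw [mu.d_apply]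
    split_ifs
    exacts [hx.1 _ _, hx.1 _ _, zero_mem _]
  · rw [mu.d_apply]
    split_ifs
    exacts [hx.2 _, hx.2 _, by omega]

theorem nu_comp_mem (n : ℕ) (x y : K.mu) (h : mu.d .plus n x = mu.d .minus n y)
    (hx : x ∈ K.nu) (hy : y ∈ K.nu) : x - mu.d .plus n x + y ∈ K.nu := by
  have hlt : ∀ m < n, ∀ β, x.1 β m = y.1 β m := fun m hm β => by
    have := congrFun (congrFun (congrArg Subtype.val h) β) m
    simpa [mu.d_apply, hm] using this
  have heq : x.1 .plus n = y.1 .minus n := by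
    have := congrFun (congrFun (congrArg Subtype.val h) .plus) n
    simpa [mu.d_apply] using this
  have val : ∀ β m, (x - mu.d .plus n x + y).1 β m =
      if m < n then y.1 β m else if m = n then x.1 β m - x.1 .plus m + y.1 β m
        else x.1 β m + y.1 β m := fun β m => by
    simp only [AddSubgroup.coe_add, AddSubgroup.coe_sub, Pi.add_apply, Pi.sub_apply, mu.d_apply]
    split_ifs <;> simp
  have val' : ∀ β, x.1 β n - x.1 .plus n + y.1 β n = x.1 β n ∨
      x.1 β n - x.1 .plus n + y.1 β n = y.1 β n := by
    rintro (_ | _)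
    · left; rw [heq]; abel
    · right; abel
  refine ⟨fun β m => ?_, fun β => ?_⟩
  · rw [val]
    split_ifs with h₁ h₂
    · exact hy.1 _ _
    · subst h₂
      rcases val' β with e | e <;> rw [e]
      exacts [hx.1 _ _, hy.1 _ _]
    · exact add_mem (hx.1 _ _) (hy.1 _ _)
  · rw [val]
    split_ifs with h₁ h₂
    · exact hy.2 _
    · subst h₂
      rcases val' β with e | e <;> rw [e]
      exacts [hx.2 _, hy.2 _]
    · omega

/-- The `ω`-category `νK`, a sub-`ω`-category of `μK`. -/
instance nu.omegaCategory : OmegaCategory K.nu :=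
  OmegaCategory.sub K.nu nu_d_mem nu_comp_mem

/-! ### Bases, atoms, unital and loop-free bases -/

/-- The intersection of `B ⊆ ⨆ₙ Kₙ` with `Kₙ`. -/
def gens (B : Set (Σ n, K.X n)) (n : ℕ) : Set (K.X n) := {x | (⟨n, x⟩ : Σ n, K.X n) ∈ B}

variable (K) in
/-- `B` is a basis for `K`: each `Kₙ` is free abelian on `B ∩ Kₙ`, and the distinguished submonoid
of `Kₙ` is generated by `B ∩ Kₙ`. -/
structure IsBasis (B : Set (Σ n, K.X n)) : Prop where
  linearIndependent : ∀ n, LinearIndependent ℤ (fun b : gens B n => (b : K.X n))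
  span_eq_top : ∀ n, Submodule.span ℤ (gens B n) = ⊤
  star_eq : ∀ n, K.star n = AddSubmonoid.closure (gens B n)

variable (K) in
/-- The partial order on `Kₙ`: `x ≤ y` if and only if `y - x` is in the distinguished submonoid. -/
def le (n : ℕ) (x y : K.X n) : Prop := y - x ∈ K.star n

variable (K) in
/-- The corresponding strict order. -/
def lt (n : ℕ) (x y : K.X n) : Prop := K.le n x y ∧ x ≠ y

namespace IsBasis

variable {B : Set (Σ n, K.X n)}

/-- `B ∩ Kₙ` as a `ℤ`-basis of `Kₙ`. -/
noncomputable def basis (hB : K.IsBasis B) (n : ℕ) : Module.Basis (gens B n) ℤ (K.X n) :=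
  Module.Basis.mk (hB.linearIndependent n) (by
    rw [Subtype.range_coe_subtype]; exact (hB.span_eq_top n).ge)

theorem mem_star_iff (hB : K.IsBasis B) (n : ℕ) (x : K.X n) :
    x ∈ K.star n ↔ 0 ≤ (hB.basis n).repr x := by
  constructor
  · intro hx
    rw [hB.star_eq] at hx
    induction hx using AddSubmonoid.closure_induction with
    | mem y hy =>
      have e : y = hB.basis n ⟨y, hy⟩ := by simp [basis]
      rw [e, Module.Basis.repr_self]
      simp
    | zero => simp
    | add y z _ _ hy hz => rw [map_add]; exact add_nonneg hy hz
  · intro hx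
    rw [← (hB.basis n).linearCombination_repr x, Finsupp.linearCombination_apply, Finsupp.sum]
    refine sum_mem fun b _ => ?_
    obtain ⟨k, hk⟩ := Int.eq_ofNat_of_zero_le (hx b)
    rw [hk, natCast_zsmul]
    refine nsmul_mem ?_ k
    rw [hB.star_eq]
    refine AddSubmonoid.subset_closure ?_
    simp [basis]

/-- The greatest lower bound `x ∧ y` in `Kₙ`, computed coordinatewise. -/
noncomputable def meet (hB : K.IsBasis B) (n : ℕ) (x y : K.X n) : K.X n :=
  (hB.basis n).repr.symm ((hB.basis n).repr x ⊓ (hB.basis n).repr y)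

theorem meet_isGLB (hB : K.IsBasis B) (n : ℕ) (x y : K.X n) :
    K.le n (hB.meet n x y) x ∧ K.le n (hB.meet n x y) y ∧
      ∀ z, K.le n z x → K.le n z y → K.le n z (hB.meet n x y) := by
  simp only [le, mem_star_iff hB, map_sub, sub_nonneg, meet, LinearEquiv.apply_symm_apply]
  exact ⟨inf_le_left, inf_le_right, fun z => le_inf⟩

/-- The positive part of a chain: the sum of its terms with positive coefficients. -/
noncomputable def pos (hB : K.IsBasis B) (n : ℕ) (x : K.X n) : K.X n :=
  (hB.basis n).repr.symm ((hB.basis n).repr x ⊔ 0)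

/-- `∂^- x` and `∂^+ x`, the negative and positive parts of `∂ x`. -/
noncomputable def bdSide (hB : K.IsBasis B) (α : Side) (n : ℕ) (x : K.X (n + 1)) : K.X n :=
  match α with
  | .minus => hB.pos n (-K.bd n x)
  | .plus => hB.pos n (K.bd n x)

theorem bdSide_sub (hB : K.IsBasis B) (n : ℕ) (x : K.X (n + 1)) :
    hB.bdSide .plus n x - hB.bdSide .minus n x = K.bd n x := by
  apply (hB.basis n).repr.injective
  ext b
  simp only [bdSide, pos, map_sub, LinearEquiv.apply_symm_apply, map_neg, Finsupp.sub_apply,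
    Finsupp.sup_apply, Finsupp.neg_apply, Finsupp.zero_apply]
  omega

theorem meet_bdSide (hB : K.IsBasis B) (n : ℕ) (x : K.X (n + 1)) :
    hB.meet n (hB.bdSide .minus n x) (hB.bdSide .plus n x) = 0 := by
  apply (hB.basis n).repr.injective
  ext b
  simp only [bdSide, pos, meet, LinearEquiv.apply_symm_apply, map_neg, Finsupp.inf_apply,
    Finsupp.sup_apply, Finsupp.neg_apply, Finsupp.zero_apply, map_zero]
  omega

/-- For `b ∈ K_p`, the chain `⟨b⟩^α_n`: it is `0` for `n > p`, it is `b` for `n = p`, and it is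
`∂^α ⟨b⟩^α_{n+1}` for `n < p`. -/
noncomputable def atomFun (hB : K.IsBasis B) (α : Side) : (p : ℕ) → K.X p → ∀ n, K.X n
  | 0, b => Function.update 0 0 b
  | p + 1, b => Function.update (atomFun hB α p (hB.bdSide α p b)) (p + 1) b

theorem atomFun_of_gt (hB : K.IsBasis B) (α : Side) (p : ℕ) (b : K.X p) (n : ℕ) (h : p < n) :
    hB.atomFun α p b n = 0 := by
  induction p with
  | zero => simp [atomFun, Function.update_of_ne (show n ≠ 0 by omega)]
  | succ p ih =>
    rw [atomFun, Function.update_of_ne (by omega)]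
    exact ih _ (by omega)

theorem atomFun_self (hB : K.IsBasis B) (α : Side) (p : ℕ) (b : K.X p) :
    hB.atomFun α p b p = b := by
  cases p <;> simp [atomFun]

theorem atomFun_of_lt (hB : K.IsBasis B) (α : Side) (p : ℕ) (b : K.X p) (n : ℕ) (h : n < p) :
    hB.atomFun α p b n = hB.bdSide α n (hB.atomFun α p b (n + 1)) := by
  induction p with
  | zero => omega
  | succ p ih =>
    rw [atomFun, Function.update_of_ne (by omega)]
    rcases Nat.lt_succ_iff_lt_or_eq.mp h with h' | rfl
    · rw [Function.update_of_ne (by omega)]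
      exact ih _ h'
    · rw [Function.update_self, atomFun_self]

theorem atomFun_bd (hB : K.IsBasis B) (p : ℕ) (b : K.X p) (n : ℕ) (h : n < p) :
    K.bd n (hB.atomFun .minus p b (n + 1)) = K.bd n (hB.atomFun .plus p b (n + 1)) := by
  obtain ⟨k, hk⟩ : ∃ k, p = n + 1 + k := ⟨p - (n + 1), by omega⟩
  induction k generalizing n with
  | zero => subst hk; simp [atomFun_self]
  | succ k ih =>
    have e := ih (n + 1) (by omega) (by omega)
    have e' := K.bd_bd n (hB.atomFun .plus p b (n + 1 + 1))
    rw [← hB.bdSide_sub (n + 1), map_sub, sub_eq_zero] at e'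
    rw [hB.atomFun_of_lt _ p b (n + 1) (by omega), hB.atomFun_of_lt _ p b (n + 1) (by omega)]
    rw [e']
    simp only [bdSide, e]

/-- The atom `⟨b⟩ ∈ μK` associated to `b ∈ K_{|b|}` (only used for basis elements `b`). -/
noncomputable def atom (hB : K.IsBasis B) (b : Σ n, K.X n) : K.mu :=
  ⟨fun α => hB.atomFun α b.1 b.2, by
    refine ⟨⟨b.1 + 1, fun n hn α => hB.atomFun_of_gt α _ _ _ hn⟩, fun α n => ?_⟩
    rcases lt_or_ge n b.1 with h | h
    · have e := hB.atomFun_bd b.1 b.2 n h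
      have e' : hB.atomFun .plus b.1 b.2 n - hB.atomFun .minus b.1 b.2 n =
          K.bd n (hB.atomFun .plus b.1 b.2 (n + 1)) := by
        rw [hB.atomFun_of_lt _ _ _ n h, hB.atomFun_of_lt _ _ _ n h, ← bdSide_sub hB]
        simp only [bdSide, e]
      cases α
      · exact e'.trans e.symm
      · exact e'
    · have e : hB.atomFun .plus b.1 b.2 n = hB.atomFun .minus b.1 b.2 n := by
        rcases h.eq_or_lt with h | h
        · subst h; simp only [atomFun_self]
        · simp only [hB.atomFun_of_gt _ _ _ n h]
      show hB.atomFun .plus b.1 b.2 n - hB.atomFun .minus b.1 b.2 n =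
        K.bd n (hB.atomFun α b.1 b.2 (n + 1))
      rw [e, hB.atomFun_of_gt _ _ _ (n + 1) (by omega), sub_self, map_zero]⟩

/-- The basis is unital: `ε⟨b⟩^-_0 = ε⟨b⟩^+_0 = 1` for every `b ∈ B`. -/
def Unital (hB : K.IsBasis B) : Prop :=
  ∀ b ∈ B, ∀ α : Side, K.aug ((hB.atom b).1 α 0) = 1

/-- The basis is loop-free: there are partial orderings `≤₀, ≤₁, …` on `B` such that `a <ₙ b`
whenever `⟨a⟩^+_n ∧ ⟨b⟩^-_n > 0` and `|a|, |b| > n`. -/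
def LoopFree (hB : K.IsBasis B) : Prop :=
  ∃ r : ℕ → PartialOrder B, ∀ (n : ℕ) (a b : B), n < a.1.1 → n < b.1.1 →
    K.lt n 0 (hB.meet n ((hB.atom a).1 .plus n) ((hB.atom b).1 .minus n)) → (r n).lt a b

/-- The atoms of `νK`. -/
def nuAtoms (hB : K.IsBasis B) : Set K.nu := {x | ∃ b ∈ B, x.1 = hB.atom b}

end IsBasis

end AugDirComplex

end Steiner

open Steiner

/-! The morphism `θ` is shown to be bijective by induction on dimension. A whiskered generator at
level m is one generator b of degree > m, composed with elements of C_m under #_k, k < m. By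
interchange, every element of C_{m+1} is a #_m-composite of such elements, a chain. In dimensions
above m, the image of a chain is the sum of the atoms of its generators, so the image determines the
generators up to order.

Surjectivity comes from loop-freeness. Suppose u in νK agrees above dimension m with a sum of atoms,
and let a be least among them for a linear extension of the order ≤_m. Then no summand has m-target
meeting the m-source of ⟨a⟩, so this source is contained in that of u, and u splits as v #_m w with
v carrying just ⟨a⟩ above dimension m (`exists_split`). Lifting the factors one at a time gives a
chain; the lifts are composable because `θ` is injective on C_m (`exists_chain_lift`).

For injectivity, two chains with the same image are sorted into a common order and compared factor
by factor (`inj_chain`). Sorting requires an exchange property: x #_m y, with x and y whiskered on a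
and b, can be rewritten with b first when the m-target of ⟨a⟩ does not meet the m-source of ⟨b⟩. The
property at level m + 1 follows from level m (`swap_succ`): the image of x #_{m+1} y lifts to a
chain at level m in which a and b lie in different factors, and a #_m-composite of two such factors
is a #_{m+1}-composite in either order.

Hence injectivity and lifting, for C_m and for whiskered generators, and the exchange property are
carried together through the induction (`LevelBijective`). At level 0, unitality makes everything
direct. -/

namespace Steiner

/-! ### Composition as a relation, strata, and interchange. -/

namespace OmegaCategory

variable {C : Type u} [OmegaCategory C]

/-- The composite `x #_n y` is defined and equal to `z`. -/
def IsComp (n : ℕ) (x y z : C) : Prop := ∃ h, comp n x y h = z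

theorem IsComp.match {n : ℕ} {x y z : C} (h : IsComp n x y z) : d .plus n x = d .minus n y := h.1

theorem IsComp.unique {n : ℕ} {x y z z' : C} (h : IsComp n x y z) (h' : IsComp n x y z') :
    z = z' := by
  obtain ⟨_, rfl⟩ := h
  obtain ⟨_, rfl⟩ := h'
  rfl

theorem exists_isComp {n : ℕ} {x y : C} (h : d .plus n x = d .minus n y) : ∃ z, IsComp n x y z :=
  ⟨_, h, rfl⟩

theorem isComp_source (n : ℕ) (x : C) : IsComp n (d .minus n x) x x := id_comp n x

theorem isComp_target (n : ℕ) (x : C) : IsComp n x (d .plus n x) x := comp_id n x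

theorem IsComp.d_minus {n : ℕ} {x y z : C} (h : IsComp n x y z) : d .minus n z = d .minus n x := by
  obtain ⟨h, rfl⟩ := h
  exact d_minus_comp n x y h

theorem IsComp.d_plus {n : ℕ} {x y z : C} (h : IsComp n x y z) : d .plus n z = d .plus n y := by
  obtain ⟨h, rfl⟩ := h
  exact d_plus_comp n x y h

theorem IsComp.d {m n : ℕ} {x y z : C} (h : IsComp n x y z) (hm : n < m) (α : Side) :
    IsComp n (OmegaCategory.d α m x) (OmegaCategory.d α m y) (OmegaCategory.d α m z) := by
  obtain ⟨h, rfl⟩ := h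
  obtain ⟨h', e⟩ := d_comp_of_gt α m n x y h hm
  exact ⟨h', e.symm⟩

theorem IsComp.assoc_left {n : ℕ} {x y z xy w : C} (h : IsComp n x y xy) (h' : IsComp n xy z w) :
    ∃ yz, IsComp n y z yz ∧ IsComp n x yz w := by
  obtain ⟨h, rfl⟩ := h
  obtain ⟨h', rfl⟩ := h'
  obtain ⟨h₃, h₄, e⟩ := OmegaCategory.assoc_left n x y z h h'
  exact ⟨_, ⟨h₃, rfl⟩, ⟨h₄, e.symm⟩⟩

theorem IsComp.assoc_right {n : ℕ} {x y z yz w : C} (h : IsComp n y z yz) (h' : IsComp n x yz w) :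
    ∃ xy, IsComp n x y xy ∧ IsComp n xy z w := by
  obtain ⟨h, rfl⟩ := h
  obtain ⟨h', rfl⟩ := h'
  obtain ⟨h₃, h₄, e⟩ := OmegaCategory.assoc_right n x y z h h'
  exact ⟨_, ⟨h₃, rfl⟩, ⟨h₄, e⟩⟩

theorem IsComp.interchange {m n : ℕ} (hmn : m < n) {x y x' y' a b z : C} (h₁ : IsComp n x y a)
    (h₂ : IsComp n x' y' b) (h₃ : IsComp m a b z) :
    ∃ s t, IsComp m x x' s ∧ IsComp m y y' t ∧ IsComp n s t z := by
  obtain ⟨h₁, rfl⟩ := h₁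
  obtain ⟨h₂, rfl⟩ := h₂
  obtain ⟨h₃, rfl⟩ := h₃
  obtain ⟨h₄, h₅, h₆, e⟩ := OmegaCategory.interchange m n x y x' y' h₁ h₂ h₃ hmn
  exact ⟨_, _, ⟨h₄, rfl⟩, ⟨h₅, rfl⟩, ⟨h₆, e.symm⟩⟩

theorem d_of_mem_stratum {n k : ℕ} {x : C} (hx : x ∈ stratum C n) (hk : n ≤ k) (α : Side) :
    d α k x = x := by
  have e : d .minus n x = x := hx
  rw [← e, d_d_of_ge _ _ _ _ _ hk]

theorem d_mem_stratum (α : Side) (n : ℕ) (x : C) : d α n x ∈ stratum C n :=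
  d_d_of_ge _ _ _ _ _ le_rfl

theorem stratum_mono {n k : ℕ} (h : n ≤ k) : stratum C n ⊆ stratum C k :=
  fun _ hx => d_of_mem_stratum hx h _

theorem exists_mem_stratum (x : C) : ∃ n, x ∈ stratum C n :=
  (exists_dim x).imp fun _ h => h.1

theorem isComp_self {n : ℕ} {x : C} (hx : x ∈ stratum C n) : IsComp n x x x := by
  have h := isComp_source n x
  rwa [d_of_mem_stratum hx le_rfl] at h

/-- An element of C_n is its own k-source and k-target for k ≥ n, so it acts as an identity for #_k.
-/
theorem IsComp.eq_right {n k : ℕ} {x y z : C} (h : IsComp k x y z) (hx : x ∈ stratum C n)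
    (hk : n ≤ k) : z = y := by
  have e := h.match
  rw [d_of_mem_stratum hx hk] at e
  subst e
  exact h.unique (isComp_source k y)

theorem IsComp.eq_left {n k : ℕ} {x y z : C} (h : IsComp k x y z) (hy : y ∈ stratum C n)
    (hk : n ≤ k) : z = x := by
  have e := h.match
  rw [d_of_mem_stratum hy hk] at e
  subst e
  exact h.unique (isComp_target k x)

theorem IsComp.mem_stratum {n k : ℕ} {x y z : C} (h : IsComp k x y z) (hx : x ∈ stratum C n)
    (hy : y ∈ stratum C n) : z ∈ stratum C n := by
  rcases lt_or_ge k n with hk | hk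
  · have h' := h.d hk .minus
    rw [d_of_mem_stratum hx le_rfl, d_of_mem_stratum hy le_rfl] at h'
    exact h'.unique h
  · rwa [h.eq_right hx hk]

/-- For `k < m`, the composite `x #_k y` is the `#_m`-composite of two whiskerings. -/
theorem IsComp.eq_whiskers {k m : ℕ} (hkm : k < m) {x y z : C} (h : IsComp k x y z) :
    ∃ s t, IsComp k x (OmegaCategory.d .minus m y) s ∧ IsComp k (OmegaCategory.d .plus m x) y t ∧
      IsComp m s t z :=
  IsComp.interchange hkm (isComp_target m x) (isComp_source m y) h

/-- The other order of the same two factors, obtained by taking identities on the opposite sides.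
Together the two forms exchange x and y across #_m, which is the source of `swap_succ`. -/
theorem IsComp.eq_whiskers' {k m : ℕ} (hkm : k < m) {x y z : C} (h : IsComp k x y z) :
    ∃ s t, IsComp k (OmegaCategory.d .minus m x) y s ∧ IsComp k x (OmegaCategory.d .plus m y) t ∧
      IsComp m s t z :=
  IsComp.interchange hkm (isComp_source m x) (isComp_target m y) h

/-! ### Whiskered generators and their chains in an arbitrary ω-category. -/

section Whiskered

variable {ι : Type w} (deg : ι → ℕ) (g : ι → C)

/-- The elements obtained from the generator `g b`, of degree greater than `m`, by composing with
elements of `C_m` under the operations `#_k` with `k < m`. -/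
inductive Whiskered (m : ℕ) (b : ι) : C → Prop
  | gen (h : m < deg b) : Whiskered m b (g b)
  | left {k : ℕ} {y x z : C} (hk : k < m) (hy : y ∈ stratum C m) (hx : Whiskered m b x)
      (h : IsComp k y x z) : Whiskered m b z
  | right {k : ℕ} {x y z : C} (hk : k < m) (hx : Whiskered m b x) (hy : y ∈ stratum C m)
      (h : IsComp k x y z) : Whiskered m b z

/-- The `#_m`-composites of sequences of whiskered generators; for the empty sequence these are
the elements of `C_m`. -/
inductive Chain (m : ℕ) : List ι → C → Prop
  | nil {x : C} (hx : x ∈ stratum C m) : Chain m [] x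
  | cons {b : ι} {l : List ι} {x y z : C} (hx : Whiskered deg g m b x) (hy : Chain m l y)
      (h : IsComp m x y z) : Chain m (b :: l) z

variable {deg g}

theorem Whiskered.lt {m : ℕ} {b : ι} {x : C} (h : Whiskered deg g m b x) : m < deg b := by
  induction h <;> assumption

theorem Whiskered.succ {m : ℕ} {b : ι} {x : C} (h : Whiskered deg g m b x) (hb : m + 1 < deg b) :
    Whiskered deg g (m + 1) b x := by
  induction h with
  | gen _ => exact .gen hb
  | left hk hy _ h ih => exact .left (by omega) (stratum_mono (by omega) hy) ih h
  | right hk _ hy h ih => exact .right (by omega) ih (stratum_mono (by omega) hy) h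

theorem Whiskered.eq_gen {b : ι} {x : C} (h : Whiskered deg g 0 b x) : x = g b := by
  cases h with
  | gen _ => rfl
  | left hk => omega
  | right hk => omega

theorem Whiskered.mem_stratum (hg : ∀ b, g b ∈ stratum C (deg b)) {m n : ℕ} {b : ι} {x : C}
    (h : Whiskered deg g m b x) (hn : deg b ≤ n) : x ∈ stratum C n := by
  have hm : m ≤ n := h.lt.le.trans hn
  induction h with
  | gen _ => exact stratum_mono hn (hg b)
  | left hk hy _ h ih => exact h.mem_stratum (stratum_mono hm hy) ih
  | right hk _ hy h ih => exact h.mem_stratum ih (stratum_mono hm hy)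

theorem Whiskered.chain {m : ℕ} {b : ι} {x : C} (h : Whiskered deg g m b x) :
    Chain deg g m [b] x :=
  .cons h (.nil (d_mem_stratum .plus m x)) (isComp_target m x)

theorem Chain.lt {m : ℕ} {l : List ι} {x : C} (h : Chain deg g m l x) : ∀ b ∈ l, m < deg b := by
  induction h with
  | nil _ => simp
  | cons hx _ _ ih => exact List.forall_mem_cons.mpr ⟨hx.lt, ih⟩

theorem Chain.mem_stratum (hg : ∀ b, g b ∈ stratum C (deg b)) {m n : ℕ} {l : List ι} {x : C}
    (h : Chain deg g m l x) (hmn : m ≤ n) (hn : ∀ b ∈ l, deg b ≤ n) : x ∈ stratum C n := by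
  induction h with
  | nil hx => exact stratum_mono hmn hx
  | cons hx _ h ih =>
    rw [List.forall_mem_cons] at hn
    exact h.mem_stratum (hx.mem_stratum hg hn.1) (ih hn.2)

theorem Chain.append {m : ℕ} {l l' : List ι} {x y z : C} (hx : Chain deg g m l x)
    (hy : Chain deg g m l' y) (h : IsComp m x y z) : Chain deg g m (l ++ l') z := by
  induction hx generalizing z with
  | nil hx => rw [h.eq_right hx le_rfl]; exact hy
  | cons hx _ h' ih =>
    obtain ⟨v, h₁, h₂⟩ := h'.assoc_left h
    exact .cons hx (ih h₁) h₂

theorem Chain.exists_of_append {m : ℕ} {l l' : List ι} {z : C}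
    (h : Chain deg g m (l ++ l') z) :
    ∃ x y, Chain deg g m l x ∧ Chain deg g m l' y ∧ IsComp m x y z := by
  induction l generalizing z with
  | nil => exact ⟨_, z, .nil (d_mem_stratum .minus m z), h, isComp_source m z⟩
  | cons b l ih =>
    cases h with
    | cons hx hy h =>
      obtain ⟨s, t, hs, ht, h'⟩ := ih hy
      obtain ⟨v, h₁, h₂⟩ := h'.assoc_right h
      exact ⟨v, t, .cons hx hs h₁, ht, h₂⟩

/-- A chain in which all but one of the generators have degree `m + 1` is whiskered at the next
level. -/
theorem Chain.whiskered (hg : ∀ b, g b ∈ stratum C (deg b)) {m : ℕ} {l l' : List ι} {b : ι} {x : C}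
    (h : Chain deg g m (l ++ b :: l') x) (hb : m + 1 < deg b) (hl : ∀ a ∈ l, deg a ≤ m + 1)
    (hl' : ∀ a ∈ l', deg a ≤ m + 1) : Whiskered deg g (m + 1) b x := by
  obtain ⟨s, t, hs, ht, h⟩ := h.exists_of_append
  cases ht with
  | cons hx hy h' =>
    -- The segments on either side of b lie in C_{m+1}, and #_m is an admissible whiskering
    -- operation at level m + 1.
    exact .left m.lt_succ_self (hs.mem_stratum hg (by omega) hl)
      (.right m.lt_succ_self (hx.succ hb) (hy.mem_stratum hg (by omega) hl') h') h

/-- Since w = w #_m w, interchange distributes whiskering by w over the #_m-factors of the chain. -/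
theorem Chain.whisker_left {m k : ℕ} (hk : k < m) {l : List ι} {w x z : C}
    (hw : w ∈ stratum C m) (hx : Chain deg g m l x) (h : IsComp k w x z) :
    Chain deg g m l z := by
  induction hx generalizing z with
  | nil hx => exact .nil (h.mem_stratum hw hx)
  | cons hx _ h' ih =>
    obtain ⟨s, t, hs, ht, h⟩ := IsComp.interchange hk (isComp_self hw) h' h
    exact .cons (.left hk hw hx hs) (ih ht) h

theorem Chain.whisker_right {m k : ℕ} (hk : k < m) {l : List ι} {w x z : C}
    (hx : Chain deg g m l x) (hw : w ∈ stratum C m) (h : IsComp k x w z) :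
    Chain deg g m l z := by
  induction hx generalizing z with
  | nil hx => exact .nil (h.mem_stratum hx hw)
  | cons hx _ h' ih =>
    obtain ⟨s, t, hs, ht, h⟩ := IsComp.interchange hk h' (isComp_self hw) h
    exact .cons (.right hk hx hw hs) (ih ht) h

/-- For k < m, interchange turns #_k into a #_m-composite of two whiskered chains, which are then
concatenated. -/
theorem Chain.comp {m k : ℕ} (hk : k ≤ m) {l l' : List ι} {x y z : C} (hx : Chain deg g m l x)
    (hy : Chain deg g m l' y) (h : IsComp k x y z) : Chain deg g m (l ++ l') z := by
  rcases hk.lt_or_eq with hk | rfl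
  · obtain ⟨s, t, hs, ht, h⟩ := h.eq_whiskers hk
    exact (hx.whisker_right hk (d_mem_stratum _ _ _) hs).append
      (hy.whisker_left hk (d_mem_stratum _ _ _) ht) h
  · exact hx.append hy h

theorem exists_chain_gen (hg : ∀ b, g b ∈ stratum C (deg b)) (m : ℕ) (b : ι) :
    ∃ l, Chain deg g m l (g b) := by
  rcases lt_or_ge m (deg b) with h | h
  · exact ⟨_, (Whiskered.gen h).chain⟩
  · exact ⟨[], .nil (stratum_mono h (hg b))⟩

/-- Inside C_{m+1} the operations #_k with k > m are trivial, and chains at level m are closed under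
the remaining ones. -/
theorem exists_chain_of_mem_stratum
    (hgen : ∀ n, stratum C n = {x | IsComposite {x | ∃ b, deg b ≤ n ∧ x = g b} x})
    (hg : ∀ b, g b ∈ stratum C (deg b)) {m : ℕ} {x : C} (hx : x ∈ stratum C (m + 1)) :
    ∃ l, Chain deg g m l x := by
  have hx' := hx
  rw [hgen] at hx'
  change IsComposite _ x at hx'
  clear hx
  suffices x ∈ stratum C (m + 1) ∧ ∃ l, Chain deg g m l x from this.2
  induction hx' with
  | base x hx =>
    obtain ⟨b, hb, rfl⟩ := hx
    exact ⟨stratum_mono hb (hg b), exists_chain_gen hg m b⟩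
  | comp k x y h _ _ ihx ihy =>
    obtain ⟨hx, l, hl⟩ := ihx
    obtain ⟨hy, l', hl'⟩ := ihy
    have hz : IsComp k x y (OmegaCategory.comp k x y h) := ⟨h, rfl⟩
    refine ⟨hz.mem_stratum hx hy, ?_⟩
    rcases le_or_gt k m with hk | hk
    · exact ⟨_, hl.comp hk hl' hz⟩
    · rw [hz.eq_left hy hk]
      exact ⟨l, hl⟩

/-- Reduces whiskered generators at level m + 1 to chains at level m, even when b has degree above m
+ 1, so that the level-m injectivity applies to them. -/
theorem Whiskered.exists_chain
    (hgen : ∀ n, stratum C n = {x | IsComposite {x | ∃ b, deg b ≤ n ∧ x = g b} x})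
    (hg : ∀ b, g b ∈ stratum C (deg b)) {m : ℕ} {b : ι} {x : C}
    (h : Whiskered deg g (m + 1) b x) : ∃ l, Chain deg g m l x := by
  induction h with
  | gen _ => exact exists_chain_gen hg m b
  | left hk hy _ h ih =>
    obtain ⟨l, hl⟩ := ih
    obtain ⟨l', hl'⟩ := exists_chain_of_mem_stratum hgen hg hy
    exact ⟨_, hl'.comp (by omega) hl h⟩
  | right hk _ hy h ih =>
    obtain ⟨l, hl⟩ := ih
    obtain ⟨l', hl'⟩ := exists_chain_of_mem_stratum hgen hg hy
    exact ⟨_, hl.comp (by omega) hl' h⟩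

theorem exists_eq_gen_of_mem_stratum_zero
    (hgen : ∀ n, stratum C n = {x | IsComposite {x | ∃ b, deg b ≤ n ∧ x = g b} x})
    (hg : ∀ b, g b ∈ stratum C (deg b)) {x : C} (hx : x ∈ stratum C 0) :
    ∃ b, deg b = 0 ∧ x = g b := by
  have hx' := hx
  rw [hgen] at hx'
  change IsComposite _ x at hx'
  clear hx
  induction hx' with
  | base x hx =>
    obtain ⟨b, hb, rfl⟩ := hx
    exact ⟨b, by omega, rfl⟩
  | comp k x y h _ _ ihx ihy =>
    obtain ⟨b, hb, hx⟩ := ihx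
    obtain ⟨c, hc, hy⟩ := ihy
    have hy : y ∈ stratum C 0 := hy ▸ hc ▸ hg c
    exact ⟨b, hb, (IsComp.eq_left ⟨h, rfl⟩ hy (Nat.zero_le k)).trans hx⟩

/-- A chain can be rearranged into any sorted order, if adjacent generators which are not in the
right order can be exchanged. -/
theorem Chain.insertionSort (r : ι → ι → Prop) [DecidableRel r] {m : ℕ}
    (hswap : ∀ a b x y z, ¬ r a b → Whiskered deg g m a x → Whiskered deg g m b y →
      IsComp m x y z → ∃ x' y', Whiskered deg g m b x' ∧ Whiskered deg g m a y' ∧ IsComp m x' y' z)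
    {l : List ι} {x : C} (h : Chain deg g m l x) : Chain deg g m (l.insertionSort r) x := by
  have insert : ∀ (l : List ι) (a : ι) (x y z : C), Whiskered deg g m a x → Chain deg g m l y →
      IsComp m x y z → Chain deg g m (l.orderedInsert r a) z := by
    intro l a
    induction l with
    | nil => exact fun x y z hx hy h => .cons hx hy h
    | cons b l ih =>
      intro x y z hx hy h
      rw [List.orderedInsert]
      split_ifs with hab
      · exact .cons hx hy h
      · cases hy with
        | cons hy ht h' =>
          -- Reassociate to bring a next to b, exchange the two, and carry a on into the tail.
          obtain ⟨s, hs, h⟩ := h'.assoc_right h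
          obtain ⟨x', y', hx', hy', h''⟩ := hswap _ _ _ _ _ hab hx hy hs
          obtain ⟨t, ht', h⟩ := h''.assoc_left h
          exact .cons hx' (ih _ _ _ hy' ht ht') h
  induction h with
  | nil hx => exact .nil hx
  | cons hx _ h ih => exact insert _ _ _ _ _ hx ih h

end Whiskered

end OmegaCategory

/-! ### Double sequences, positivity and sums of atoms. -/

namespace AugDirComplex

variable {K : AugDirComplex.{v}}

/-- The operator d^α_m retains only one of the two terms in dimension m; the other is recovered from
the boundary of the term in dimension m + 1. -/
theorem mu.ext_of_d {m : ℕ} {u v : K.mu} (α : Side) (h : ∀ β j, m < j → u.1 β j = v.1 β j)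
    (hd : mu.d α m u = mu.d α m v) : u = v := by
  have hd' : ∀ β j, (mu.d α m u).1 β j = (mu.d α m v).1 β j := fun β j => by rw [hd]
  ext β j
  rcases lt_trichotomy j m with hj | rfl | hj
  · simpa [mu.d_apply, hj] using hd' β j
  · have e : u.1 α j = v.1 α j := by simpa [mu.d_apply] using hd' α j
    have eu := u.2.2 .plus j
    have ev := v.2.2 .plus j
    rw [← h .plus (j + 1) j.lt_succ_self, ← eu] at ev
    cases α <;> cases β <;> first
      | exact e
      | (rw [e] at ev; simpa using ev.symm)
  · exact h β j hj

theorem mu.aug_eq (u : K.mu) : K.aug (u.1 .plus 0) = K.aug (u.1 .minus 0) := by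
  have h := u.2.2 .plus 0
  rw [← sub_eq_zero, ← map_sub, h, K.aug_bd]

theorem mem_nu_of_minus {u : K.mu} (h : ∀ α n, u.1 α n ∈ K.star n)
    (h₀ : K.aug (u.1 .minus 0) = 1) : u ∈ K.nu :=
  ⟨h, fun α => by cases α; exacts [h₀, (mu.aug_eq u).trans h₀]⟩

theorem mem_nu_of_d {m : ℕ} {u : K.mu} (h : ∀ α j, m < j → u.1 α j ∈ K.star j)
    (hd : ∀ α, mu.d α m u ∈ K.nu) : u ∈ K.nu := by
  refine ⟨fun α j => ?_, fun α => ?_⟩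
  · rcases lt_or_ge m j with hj | hj
    · exact h α j hj
    · have h' := (hd α).1 α j
      rcases hj.lt_or_eq with hj | rfl
      · simpa [mu.d_apply, hj] using h'
      · simpa [mu.d_apply] using h'
  · have h' := (hd α).2 α
    rcases m.eq_zero_or_pos with rfl | hm
    · simpa [mu.d_apply] using h'
    · simpa [mu.d_apply, hm] using h'

namespace IsBasis

variable {B : Set (Σ n, K.X n)} (hB : K.IsBasis B)
include hB

theorem meet_eq_zero_iff {n : ℕ} {x y : K.X n} (hx : x ∈ K.star n) (hy : y ∈ K.star n) :
    hB.meet n x y = 0 ↔ ∀ b, (hB.basis n).repr x b = 0 ∨ (hB.basis n).repr y b = 0 := by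
  rw [mem_star_iff hB] at hx hy
  rw [meet, LinearEquiv.map_eq_zero_iff, Finsupp.ext_iff]
  refine forall_congr' fun b => ?_
  have hxb : 0 ≤ (hB.basis n).repr x b := hx b
  have hyb : 0 ≤ (hB.basis n).repr y b := hy b
  rw [Finsupp.inf_apply, Finsupp.zero_apply]
  omega

theorem meet_mem_star {n : ℕ} {x y : K.X n} (hx : x ∈ K.star n) (hy : y ∈ K.star n) :
    hB.meet n x y ∈ K.star n := by
  have h := (hB.meet_isGLB n x y).2.2 0
  simp only [le, sub_zero] at h
  exact h hx hy

theorem lt_meet_of_ne {n : ℕ} {x y : K.X n} (hx : x ∈ K.star n) (hy : y ∈ K.star n)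
    (h : hB.meet n x y ≠ 0) : K.lt n 0 (hB.meet n x y) :=
  ⟨by rw [le, sub_zero]; exact hB.meet_mem_star hx hy, h.symm⟩

theorem meet_sum_eq_zero {n : ℕ} {l : List (K.X n)} {y : K.X n} (hl : ∀ x ∈ l, x ∈ K.star n)
    (hy : y ∈ K.star n) (h : ∀ x ∈ l, hB.meet n x y = 0) : hB.meet n l.sum y = 0 := by
  rw [hB.meet_eq_zero_iff (list_sum_mem hl) hy]
  intro b
  by_cases hb : (hB.basis n).repr y b = 0
  · exact .inr hb
  · refine .inl ?_
    have h' : ∀ x ∈ l, (hB.basis n).repr x b = 0 := fun x hx =>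
      ((hB.meet_eq_zero_iff (hl x hx) hy).mp (h x hx) b).resolve_right hb
    clear hl h
    induction l with
    | nil => simp
    | cons a l ih =>
      rw [List.forall_mem_cons] at h'
      rw [List.sum_cons, map_add, Finsupp.add_apply, h'.1, ih h'.2, add_zero]

/-- If `z ≤ x + y` and `x ∧ z = 0` then `z ≤ y`. -/
theorem sub_mem_star {n : ℕ} {x y z : K.X n} (hx : x ∈ K.star n) (hy : y ∈ K.star n)
    (hz : z ∈ K.star n) (h : x + y - z ∈ K.star n) (hxz : hB.meet n x z = 0) :
    y - z ∈ K.star n := by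
  rw [hB.meet_eq_zero_iff hx hz] at hxz
  rw [mem_star_iff hB] at *
  intro b
  have h₁ := h b
  have h₂ := hy b
  have h₃ := hxz b
  simp only [map_add, map_sub, Finsupp.add_apply, Finsupp.sub_apply, Finsupp.zero_apply] at *
  omega

theorem mem_star_of_mem {n : ℕ} {x : K.X n} (hx : x ∈ gens B n) : x ∈ K.star n := by
  rw [hB.star_eq]
  exact AddSubmonoid.subset_closure hx

theorem pos_mem_star (n : ℕ) (x : K.X n) : hB.pos n x ∈ K.star n := by
  rw [mem_star_iff hB, pos, LinearEquiv.apply_symm_apply]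
  exact le_sup_right

theorem bdSide_mem_star (α : Side) (n : ℕ) (x : K.X (n + 1)) : hB.bdSide α n x ∈ K.star n := by
  cases α <;> exact hB.pos_mem_star _ _

theorem atom_apply_mem_star {b : Σ n, K.X n} (hb : b ∈ B) (α : Side) (n : ℕ) :
    (hB.atom b).1 α n ∈ K.star n := by
  change hB.atomFun α b.1 b.2 n ∈ K.star n
  rcases lt_trichotomy n b.1 with h | rfl | h
  · rw [hB.atomFun_of_lt _ _ _ _ h]
    exact hB.bdSide_mem_star _ _ _
  · rw [hB.atomFun_self]
    exact hB.mem_star_of_mem hb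
  · rw [hB.atomFun_of_gt _ _ _ _ h]
    exact zero_mem _

theorem atom_apply_self (b : Σ n, K.X n) (α : Side) : (hB.atom b).1 α b.1 = b.2 :=
  hB.atomFun_self α _ _

theorem atom_apply_of_gt (b : Σ n, K.X n) (α : Side) {n : ℕ} (h : b.1 < n) :
    (hB.atom b).1 α n = 0 :=
  hB.atomFun_of_gt α _ _ _ h

theorem atom_mem_nu (hu : hB.Unital) {b : Σ n, K.X n} (hb : b ∈ B) : hB.atom b ∈ K.nu :=
  ⟨hB.atom_apply_mem_star hb, hu b hb⟩

/-- The sum of the atoms in a list. -/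
noncomputable def atomSum (l : List B) : K.mu := (l.map fun b => hB.atom b.1).sum

theorem atomSum_nil : hB.atomSum [] = 0 := rfl

theorem atomSum_cons (b : B) (l : List B) :
    hB.atomSum (b :: l) = hB.atom b.1 + hB.atomSum l := by
  simp [atomSum]

theorem atomSum_append (l l' : List B) :
    hB.atomSum (l ++ l') = hB.atomSum l + hB.atomSum l' := by
  simp [atomSum]

theorem atomSum_perm {l l' : List B} (h : l.Perm l') : hB.atomSum l = hB.atomSum l' :=
  (h.map _).sum_eq

theorem atomSum_apply (l : List B) (α : Side) (n : ℕ) :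
    (hB.atomSum l).1 α n = (l.map fun b => (hB.atom b.1).1 α n).sum := by
  induction l with
  | nil => rfl
  | cons b l ih => rw [atomSum_cons, List.map_cons, List.sum_cons, ← ih]; rfl

theorem atomSum_mem_star (l : List B) (α : Side) (n : ℕ) :
    (hB.atomSum l).1 α n ∈ K.star n := by
  rw [atomSum_apply]
  refine list_sum_mem fun x hx => ?_
  obtain ⟨b, _, rfl⟩ := List.mem_map.mp hx
  exact hB.atom_apply_mem_star b.2 α n

theorem atomSum_apply_of_gt {l : List B} {n : ℕ} (h : ∀ b ∈ l, b.1.1 < n) (α : Side) :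
    (hB.atomSum l).1 α n = 0 := by
  rw [atomSum_apply]
  refine List.sum_eq_zero fun x hx => ?_
  obtain ⟨b, hb, rfl⟩ := List.mem_map.mp hx
  exact hB.atom_apply_of_gt b.1 α (h b hb)

/-- Every element of `K_n^*` is the top term of a sum of `n`-dimensional atoms. -/
theorem exists_atomSum {n : ℕ} {x : K.X n} (hx : x ∈ K.star n) :
    ∃ l : List B, (∀ b ∈ l, b.1.1 = n) ∧ ∀ α, (hB.atomSum l).1 α n = x := by
  rw [hB.star_eq] at hx
  induction hx using AddSubmonoid.closure_induction with
  | mem y hy =>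
    refine ⟨[⟨⟨n, y⟩, hy⟩], by simp, fun α => ?_⟩
    rw [atomSum_apply]
    simpa using hB.atom_apply_self ⟨n, y⟩ α
  | zero => exact ⟨[], by simp, fun α => rfl⟩
  | add y z _ _ hy hz =>
    obtain ⟨l, hl, hy⟩ := hy
    obtain ⟨l', hl', hz⟩ := hz
    refine ⟨l ++ l', fun b hb => (List.mem_append.mp hb).elim (hl b) (hl' b), fun α => ?_⟩
    rw [← hy α, ← hz α, atomSum_append]
    rfl

open Classical in
/-- The coefficient of a generator of maximal dimension in a sum of atoms is its multiplicity. -/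
theorem repr_atomSum {l : List B} {a : B} (h : ∀ b ∈ l, b.1.1 ≤ a.1.1) (α : Side) :
    (hB.basis a.1.1).repr ((hB.atomSum l).1 α a.1.1) ⟨a.1.2, a.2⟩ = l.count a := by
  induction l with
  | nil => simp [atomSum_nil]
  | cons b l ih =>
    rw [List.forall_mem_cons] at h
    rw [atomSum_cons, AddSubgroup.coe_add, Pi.add_apply, Pi.add_apply, map_add, Finsupp.add_apply,
      ih h.2, List.count_cons, Nat.cast_add, add_comm]
    congr 1
    rcases h.1.lt_or_eq with hb | hb
    · have hab : b.1 ≠ a.1 := fun e => by rw [e] at hb; omega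
      rw [hB.atom_apply_of_gt b.1 α hb]
      simp [hab]
    · obtain ⟨⟨p, a⟩, ha⟩ := a
      obtain ⟨⟨q, b⟩, hb'⟩ := b
      obtain rfl : q = p := hb
      have e : (hB.atom ⟨q, b⟩).1 α q = hB.basis q ⟨b, hb'⟩ := by
        rw [hB.atom_apply_self ⟨q, b⟩ α]
        simp [basis]
      rw [e, Module.Basis.repr_self]
      by_cases hab : b = a
      · subst hab
        simp
      · have hab' : (⟨b, hb'⟩ : gens B q) ≠ ⟨a, ha⟩ := fun h => hab (congrArg Subtype.val h)
        rw [Finsupp.single_eq_of_ne hab'.symm]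
        simp [hab]

/-- A sum of atoms of dimension greater than `m` is determined, up to the order of the summands, by
its terms in dimensions greater than `m`. -/
theorem perm_of_atomSum_eq {m : ℕ} {l l' : List B} (hl : ∀ b ∈ l, m < b.1.1)
    (hl' : ∀ b ∈ l', m < b.1.1)
    (h : ∀ j, m < j → (hB.atomSum l).1 .minus j = (hB.atomSum l').1 .minus j) : l.Perm l' := by
  classical
  induction hn : l.length generalizing l l' with
  | zero =>
    obtain rfl := List.length_eq_zero_iff.mp hn
    cases l' with
    | nil => rfl
    | cons b l' =>
      -- A top-dimensional summand of the nonempty list would have positive multiplicity, but its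
      -- coefficient in the empty sum is 0.
      obtain ⟨a, ha, hmax⟩ := (b :: l').toFinset.exists_max_image (fun b => b.1.1)
        ⟨b, by simp⟩
      rw [List.mem_toFinset] at ha
      have e := hB.repr_atomSum (l := b :: l') (a := a)
        (fun c hc => hmax c (List.mem_toFinset.mpr hc)) .minus
      rw [← h _ (hl' a ha), atomSum_nil] at e
      have := List.count_pos_iff.mpr ha
      simp only [ZeroMemClass.coe_zero, Pi.zero_apply, map_zero, Finsupp.coe_zero] at e
      omega
  | succ n ih =>
    -- Taking a of maximal dimension over both lists makes its coefficient equal to its multiplicity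
    -- in each; one copy is then cancelled from both.
    obtain ⟨a, ha, hmax⟩ := (l ++ l').toFinset.exists_max_image (fun b => b.1.1) (by
      cases l with
      | nil => simp at hn
      | cons b l => exact ⟨b, by simp⟩)
    simp only [List.mem_toFinset, List.mem_append] at ha hmax
    have e := hB.repr_atomSum (l := l) (a := a) (fun c hc => hmax c (.inl hc)) .minus
    rw [h _ (ha.elim (hl a) (hl' a)),
      hB.repr_atomSum (l := l') (a := a) (fun c hc => hmax c (.inr hc)) .minus] at e
    have e' : l'.count a = l.count a := by exact_mod_cast e
    have hal : a ∈ l := by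
      rw [← List.count_pos_iff]
      rcases ha with ha | ha
      · exact List.count_pos_iff.mpr ha
      · rw [← e']; exact List.count_pos_iff.mpr ha
    have hal' : a ∈ l' := by
      rw [← List.count_pos_iff, e']; exact List.count_pos_iff.mpr hal
    refine (List.perm_cons_erase hal).trans
      (((ih (l := l.erase a) (l' := l'.erase a) ?_ ?_ ?_ ?_).cons a).trans
        (List.perm_cons_erase hal').symm)
    · exact fun b hb => hl b (List.mem_of_mem_erase hb)
    · exact fun b hb => hl' b (List.mem_of_mem_erase hb)
    · intro j hj
      have e := h j hj
      rw [hB.atomSum_perm (List.perm_cons_erase hal), hB.atomSum_perm (List.perm_cons_erase hal'),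
        atomSum_cons, atomSum_cons] at e
      exact add_left_cancel e
    · rw [List.length_erase_of_mem hal, hn]; rfl

/-- If the terms of `u ∈ νK` above dimension `m` are those of a sum of atoms, and none of the
atoms has `m`-dimensional target meeting the `m`-dimensional source of `⟨a⟩`, then this source is
contained in that of `u`. -/
theorem sub_atom_mem_star {m : ℕ} {u : K.mu} (hu : u ∈ K.nu) {l : List B} {a : B} (ha : a ∈ l)
    (h : u.1 .minus (m + 1) = (hB.atomSum l).1 .minus (m + 1))
    (hl : ∀ b ∈ l, hB.meet m ((hB.atom b.1).1 .plus m) ((hB.atom a.1).1 .minus m) = 0) :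
    u.1 .minus m - (hB.atom a.1).1 .minus m ∈ K.star m := by
  refine hB.sub_mem_star (x := (hB.atomSum l).1 .plus m) (hB.atomSum_mem_star l _ _) (hu.1 _ _)
    (hB.atom_apply_mem_star a.2 _ _) ?_ ?_
  · have e₁ := u.2.2 .minus m
    have e₂ := (hB.atomSum l).2.2 .minus m
    rw [h, ← e₂] at e₁
    obtain ⟨s, t, rfl⟩ := List.append_of_mem ha
    have e₃ : hB.atomSum (s ++ a :: t) = hB.atom a.1 + hB.atomSum (s ++ t) := by
      rw [← atomSum_cons]
      exact hB.atomSum_perm List.perm_middle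
    have e : (hB.atomSum (s ++ a :: t)).1 .plus m + u.1 .minus m - (hB.atom a.1).1 .minus m =
        u.1 .plus m + (hB.atomSum (s ++ t)).1 .minus m := by
      rw [sub_eq_sub_iff_add_eq_add] at e₁
      rw [← e₁, e₃]
      simp only [AddSubgroup.coe_add, Pi.add_apply]
      abel
    rw [e]
    exact add_mem (hu.1 _ _) (hB.atomSum_mem_star _ _ _)
  · rw [atomSum_apply]
    refine hB.meet_sum_eq_zero ?_ (hB.atom_apply_mem_star a.2 _ _) ?_
    · intro x hx
      obtain ⟨b, _, rfl⟩ := List.mem_map.mp hx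
      exact hB.atom_apply_mem_star b.2 _ _
    · intro x hx
      obtain ⟨b, hb, rfl⟩ := List.mem_map.mp hx
      exact hl b hb

/-- Splitting off an atom from an element of `νK`. -/
theorem exists_split {m : ℕ} {u : K.mu} (hu : u ∈ K.nu) {a : B} {l : List B}
    (h : ∀ β j, m < j → u.1 β j = (hB.atomSum (a :: l)).1 β j)
    (hl : ∀ b ∈ a :: l, hB.meet m ((hB.atom b.1).1 .plus m) ((hB.atom a.1).1 .minus m) = 0) :
    ∃ v ∈ K.nu, ∃ w ∈ K.nu, mu.d .plus m v = mu.d .minus m w ∧ v - mu.d .plus m v + w = u ∧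
      (∀ β j, m < j → v.1 β j = (hB.atom a.1).1 β j) ∧
      ∀ β j, m < j → w.1 β j = (hB.atomSum l).1 β j := by
  have hs := hB.sub_atom_mem_star hu List.mem_cons_self (h _ _ m.lt_succ_self) hl
  -- The m-source of u with the m-source of ⟨a⟩ replaced by ⟨a⟩ itself. Positivity in dimension m is
  -- exactly `hs`.
  set v : K.mu := mu.d .minus m u + (hB.atom a.1 - mu.d .minus m (hB.atom a.1)) with hv
  have v_lt : ∀ β j, j < m → v.1 β j = u.1 β j := fun β j hj => by
    simp [hv, mu.d_apply, hj]
  have v_eq : ∀ β, v.1 β m = u.1 .minus m - (hB.atom a.1).1 .minus m + (hB.atom a.1).1 β m :=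
    fun β => by simp [hv, mu.d_apply]; abel
  have v_gt : ∀ β j, m < j → v.1 β j = (hB.atom a.1).1 β j := fun β j hj => by
    simp [hv, mu.d_apply, hj.not_gt, hj.ne']
  have hvn : v ∈ K.nu := by
    refine mem_nu_of_minus (fun β j => ?_) ?_
    · rcases lt_trichotomy j m with hj | rfl | hj
      · rw [v_lt β j hj]; exact hu.1 _ _
      · rw [v_eq]; exact add_mem hs (hB.atom_apply_mem_star a.2 _ _)
      · rw [v_gt β j hj]; exact hB.atom_apply_mem_star a.2 _ _
    · rcases m.eq_zero_or_pos with rfl | hm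
      · rw [v_eq, sub_add_cancel]; exact hu.2 _
      · rw [v_lt _ _ hm]; exact hu.2 _
  have hd : mu.d .minus m v = mu.d .minus m u := by
    rw [hv, mu.d_add, mu.d_sub, mu.d_d_of_ge _ _ _ _ _ le_rfl, mu.d_d_of_ge _ _ _ _ _ le_rfl]
    abel
  -- Forced by the formula for v #_m w = u.
  set w : K.mu := u - v + mu.d .plus m v with hw
  have hdw : mu.d .minus m w = mu.d .plus m v := by
    rw [hw, mu.d_add, mu.d_sub, mu.d_d_of_ge _ _ _ _ _ le_rfl, hd]
    abel
  have hdw' : mu.d .plus m w = mu.d .plus m u := by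
    rw [hw, mu.d_add, mu.d_sub, mu.d_d_of_ge _ _ _ _ _ le_rfl]
    abel
  have w_gt : ∀ β j, m < j → w.1 β j = (hB.atomSum l).1 β j := fun β j hj => by
    have e : w.1 β j = u.1 β j - v.1 β j := by
      simp [hw, mu.d_apply, hj.not_gt, hj.ne']
    rw [e, h β j hj, v_gt β j hj, atomSum_cons, AddSubgroup.coe_add, Pi.add_apply, Pi.add_apply,
      add_sub_cancel_left]
  refine ⟨v, hvn, w, mem_nu_of_d (m := m) (fun β j hj => ?_) (fun β => ?_), hdw.symm, ?_, v_gt,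
    w_gt⟩
  · rw [w_gt β j hj]; exact hB.atomSum_mem_star _ _ _
  · cases β
    · rw [hdw]; exact nu_d_mem _ _ _ hvn
    · rw [hdw']; exact nu_d_mem _ _ _ hu
  · rw [hw]; abel

end IsBasis
end AugDirComplex

open OmegaCategory AugDirComplex AugDirComplex.IsBasis

/-! ### Images of chains, and orderings from loop-freeness. -/

section Lift

variable {C : Type u} [OmegaCategory C] {K : AugDirComplex.{v}} {B : Set (Σ n, K.X n)}

theorem OmegaHom.coe_map_d (θ : OmegaHom C K.nu) (α : Side) (n : ℕ) (x : C) :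
    (θ.toFun (d α n x)).1 = mu.d α n (θ.toFun x).1 :=
  congrArg Subtype.val (θ.map_d α n x)

theorem OmegaHom.coe_map_isComp (θ : OmegaHom C K.nu) {n : ℕ} {x y z : C} (h : IsComp n x y z) :
    (θ.toFun z).1 = (θ.toFun x).1 - mu.d .plus n (θ.toFun x).1 + (θ.toFun y).1 := by
  obtain ⟨h, rfl⟩ := h
  exact congrArg Subtype.val (θ.map_comp n x y h)

theorem OmegaHom.map_isComp_apply (θ : OmegaHom C K.nu) {n j : ℕ} {x y z : C}
    (h : IsComp n x y z) (hj : n < j) (α : Side) :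
    (θ.toFun z).1.1 α j = (θ.toFun x).1.1 α j + (θ.toFun y).1.1 α j := by
  rw [θ.coe_map_isComp h]
  simp [mu.d_apply, hj.not_gt, hj.ne']

theorem OmegaHom.map_stratum_apply (θ : OmegaHom C K.nu) {m j : ℕ} {x : C}
    (hx : x ∈ stratum C m) (hj : m < j) (α : Side) : (θ.toFun x).1.1 α j = 0 := by
  rw [← d_of_mem_stratum hx le_rfl .minus, θ.coe_map_d, mu.d_apply, if_neg hj.not_gt,
    if_neg hj.ne']

/-- The family `g` of elements of `C` maps to the family of atoms and composition-generates `C`. -/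
structure IsGeneratorLift (hB : K.IsBasis B) (θ : OmegaHom C K.nu) (g : B → C) : Prop where
  map_gen : ∀ b, (θ.toFun (g b)).1 = hB.atom b.1
  stratum_eq : ∀ n, stratum C n = {x | IsComposite {x | ∃ b : B, b.1.1 ≤ n ∧ x = g b} x}

namespace IsGeneratorLift

variable {hB : K.IsBasis B} {θ : OmegaHom C K.nu} {g : B → C} (hg : IsGeneratorLift hB θ g)
include hg

theorem gen_mem_stratum (b : B) : g b ∈ stratum C b.1.1 := by
  rw [hg.stratum_eq]
  exact .base _ ⟨b, le_rfl, rfl⟩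

theorem map_whiskered_apply {m j : ℕ} {b : B} {x : C}
    (h : Whiskered (fun b : B => b.1.1) g m b x) (hj : m < j) (α : Side) :
    (θ.toFun x).1.1 α j = (hB.atom b.1).1 α j := by
  induction h with
  | gen _ => rw [hg.map_gen]
  | left hk hy _ h ih =>
    rw [θ.map_isComp_apply h (hk.trans hj), θ.map_stratum_apply hy hj, ih, zero_add]
  | right hk _ hy h ih =>
    rw [θ.map_isComp_apply h (hk.trans hj), θ.map_stratum_apply hy hj, ih, add_zero]

theorem map_chain_apply {m j : ℕ} {l : List B} {x : C}
    (h : Chain (fun b : B => b.1.1) g m l x) (hj : m < j) (α : Side) :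
    (θ.toFun x).1.1 α j = (hB.atomSum l).1 α j := by
  induction h with
  | nil hx => exact θ.map_stratum_apply hx hj α
  | cons hx _ h ih =>
    rw [θ.map_isComp_apply h hj, hg.map_whiskered_apply hx hj, ih, atomSum_cons]
    rfl

/-- Above dimension m both images agree with ⟨b⟩, so one common m-source or m-target suffices. -/
theorem map_eq_of_whiskered {m : ℕ} {b : B} {x y : C}
    (hx : Whiskered (fun b : B => b.1.1) g m b x) (hy : Whiskered (fun b : B => b.1.1) g m b y)
    (α : Side) (h : mu.d α m (θ.toFun x).1 = mu.d α m (θ.toFun y).1) :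
    θ.toFun x = θ.toFun y := by
  refine Subtype.ext (mu.ext_of_d α (fun β j hj => ?_) h)
  rw [hg.map_whiskered_apply hx hj, hg.map_whiskered_apply hy hj]

end IsGeneratorLift

/-- Extend ≤_m to a linear order s. A nonzero meet would force a <_m b, contradicting s b a by
antisymmetry. -/
theorem AugDirComplex.IsBasis.LoopFree.exists_linearOrder {hB : K.IsBasis B}
    (h : hB.LoopFree) (m : ℕ) : ∃ s : B → B → Prop, IsLinearOrder B s ∧
      ∀ a b : B, m < a.1.1 → m < b.1.1 → s b a →
        hB.meet m ((hB.atom a.1).1 .plus m) ((hB.atom b.1).1 .minus m) = 0 := by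
  obtain ⟨r, hr⟩ := h
  let := r m
  obtain ⟨s, hs, hrs⟩ := extend_partialOrder ((· ≤ ·) : B → B → Prop)
  refine ⟨s, hs, fun a b ha hb hba => ?_⟩
  by_contra hne
  have hab : a < b := hr m a b ha hb
    (hB.lt_meet_of_ne (hB.atom_apply_mem_star a.2 _ _) (hB.atom_apply_mem_star b.2 _ _) hne)
  exact hab.ne (antisymm_of s (hrs _ _ hab.le) hba)

theorem AugDirComplex.IsBasis.LoopFree.meet_self {hB : K.IsBasis B} (h : hB.LoopFree) {m : ℕ}
    {b : B} (hb : m < b.1.1) :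
    hB.meet m ((hB.atom b.1).1 .plus m) ((hB.atom b.1).1 .minus m) = 0 := by
  obtain ⟨s, hs, h⟩ := h.exists_linearOrder m
  exact h b b hb hb (refl_of s b)

/-- The properties of `θ` at level `m`, proved by induction on `m`. -/
structure LevelBijective (hB : K.IsBasis B) (θ : OmegaHom C K.nu) (g : B → C) (m : ℕ) : Prop where
  inj_stratum : ∀ x y, x ∈ stratum C m → y ∈ stratum C m → θ.toFun x = θ.toFun y → x = y
  inj_whiskered : ∀ b x y, Whiskered (fun b : B => b.1.1) g m b x →
    Whiskered (fun b : B => b.1.1) g m b y → θ.toFun x = θ.toFun y → x = y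
  lift_stratum : ∀ u : K.nu, (∀ β j, m < j → u.1.1 β j = 0) → ∃ x ∈ stratum C m, θ.toFun x = u
  lift_whiskered : ∀ (b : B) (u : K.nu), m < b.1.1 →
    (∀ β j, m < j → u.1.1 β j = (hB.atom b.1).1 β j) →
      ∃ x, Whiskered (fun b : B => b.1.1) g m b x ∧ θ.toFun x = u
  swap : ∀ a b x y z, hB.meet m ((hB.atom a.1).1 .plus m) ((hB.atom b.1).1 .minus m) = 0 →
    Whiskered (fun b : B => b.1.1) g m a x → Whiskered (fun b : B => b.1.1) g m b y →
      IsComp m x y z → ∃ x' y', Whiskered (fun b : B => b.1.1) g m b x' ∧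
        Whiskered (fun b : B => b.1.1) g m a y' ∧ IsComp m x' y' z

/-! ### The induction step from level m to level m + 1. -/

namespace LevelBijective

variable {hB : K.IsBasis B} {θ : OmegaHom C K.nu} {g : B → C} {m : ℕ}
  (H : LevelBijective hB θ g m) (hg : IsGeneratorLift hB θ g) (hlf : hB.LoopFree)
include H

theorem exists_chain_lift (hlf : hB.LoopFree) (l : List B) (hl : ∀ b ∈ l, m < b.1.1) (u : K.nu)
    (hu : ∀ β j, m < j → u.1.1 β j = (hB.atomSum l).1 β j) :
    ∃ l', l'.Perm l ∧ ∃ x, Chain (fun b : B => b.1.1) g m l' x ∧ θ.toFun x = u := by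
  classical
  obtain ⟨s, hs, hsm⟩ := hlf.exists_linearOrder m
  have sorted : ∀ l : List B, l.Pairwise s → (∀ b ∈ l, m < b.1.1) → ∀ u : K.nu,
      (∀ β j, m < j → u.1.1 β j = (hB.atomSum l).1 β j) →
        ∃ x, Chain (fun b : B => b.1.1) g m l x ∧ θ.toFun x = u := by
    intro l
    induction l with
    | nil =>
      intro _ _ u hu
      obtain ⟨x, hx, e⟩ := H.lift_stratum u hu
      exact ⟨x, .nil hx, e⟩
    | cons a l ih =>
      intro hp hl u hu
      rw [List.pairwise_cons] at hp
      have ha := hl a List.mem_cons_self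
      -- The head a is s-least, so no summand, a itself included, has m-target meeting the m-source
      -- of ⟨a⟩.
      obtain ⟨v, hv, w, hw, hvw, huvw, hva, hwl⟩ := hB.exists_split u.2 hu (by
        intro b hb
        refine hsm b a (hl b hb) ha ?_
        rcases List.mem_cons.mp hb with rfl | hb
        exacts [refl_of s _, hp.1 b hb])
      obtain ⟨x, hx, hxv⟩ := H.lift_whiskered a ⟨v, hv⟩ ha hva
      obtain ⟨y, hy, hyw⟩ := ih hp.2 (fun b hb => hl b (List.mem_cons_of_mem _ hb)) ⟨w, hw⟩ hwl
      -- The lifts were chosen independently; they match because `θ` is injective on C_m.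
      have e : d .plus m x = d .minus m y := by
        refine H.inj_stratum _ _ (d_mem_stratum _ _ _) (d_mem_stratum _ _ _) (Subtype.ext ?_)
        rw [θ.coe_map_d, θ.coe_map_d, hxv, hyw]
        exact hvw
      obtain ⟨z, hz⟩ := exists_isComp e
      refine ⟨z, .cons hx hy hz, Subtype.ext ?_⟩
      rw [θ.coe_map_isComp hz, hxv, hyw]
      exact huvw
  have hperm := List.perm_insertionSort s l
  refine ⟨l.insertionSort s, hperm, sorted _ (List.pairwise_insertionSort s l)
    (fun b hb => hl b (hperm.mem_iff.mp hb)) u fun β j hj => ?_⟩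
  rw [hu β j hj, hB.atomSum_perm hperm]

/-- An element of `νK` whose terms above dimension `m + 1` are those of a sum of atoms, and whose
terms in dimension `m + 1` exceed those of the sum by a fixed chain, lifts to a chain at level
`m`. -/
theorem exists_chain_lift_succ (hlf : hB.LoopFree) (l : List B) (hl : ∀ b ∈ l, m < b.1.1) (u : K.nu)
    (hu : ∀ β j, m + 1 < j → u.1.1 β j = (hB.atomSum l).1 β j) {t : K.X (m + 1)}
    (ht : t ∈ K.star (m + 1))
    (hut : ∀ β, u.1.1 β (m + 1) = (hB.atomSum l).1 β (m + 1) + t) :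
    ∃ l₁, (∀ b ∈ l₁, b.1.1 ≤ m + 1) ∧ ∃ l', l'.Perm (l ++ l₁) ∧
      ∃ x, Chain (fun b : B => b.1.1) g m l' x ∧ θ.toFun x = u := by
  -- The excess t is a sum of (m + 1)-dimensional atoms, which contribute nothing above dimension m
  -- + 1.
  obtain ⟨l₁, hl₁, ht⟩ := hB.exists_atomSum ht
  refine ⟨l₁, fun b hb => (hl₁ b hb).le, H.exists_chain_lift hlf _ (fun b hb => ?_) u
    fun β j hj => ?_⟩
  · rcases List.mem_append.mp hb with hb | hb
    · exact hl b hb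
    · have := hl₁ b hb
      omega
  · rw [atomSum_append, AddSubgroup.coe_add, Pi.add_apply, Pi.add_apply]
    rcases (Nat.succ_le_of_lt hj).eq_or_lt with rfl | hj
    · rw [ht β]
      exact hut β
    · rw [hu β j hj, hB.atomSum_apply_of_gt (l := l₁) (fun b hb => (hl₁ b hb).trans_lt hj),
        add_zero]

include hg

/-- The first factors share the m-source of the whole and the generator, so they coincide;
cancelling them in the formula for #_m leaves the tails. -/
theorem inj_chain_same {l : List B} {x y : C} (hx : Chain (fun b : B => b.1.1) g m l x)
    (hy : Chain (fun b : B => b.1.1) g m l y) (h : θ.toFun x = θ.toFun y) : x = y := by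
  induction hx generalizing y with
  | nil hx =>
    cases hy with
    | nil hy => exact H.inj_stratum _ _ hx hy h
  | cons hx _ hxz ih =>
    cases hy with
    | cons hy hy' hyz =>
      have e := hg.map_eq_of_whiskered hx hy .minus (by
        rw [← θ.coe_map_d, ← θ.coe_map_d, ← hxz.d_minus, ← hyz.d_minus, θ.map_d, h, ← θ.map_d])
      obtain rfl := H.inj_whiskered _ _ _ hx hy e
      have e' := congrArg Subtype.val h
      rw [θ.coe_map_isComp hxz, θ.coe_map_isComp hyz] at e'
      obtain rfl := ih hy' (Subtype.ext (add_left_cancel e'))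
      exact hxz.unique hyz

include hlf

/-- The terms above dimension m determine the generators up to order, and the exchange property
sorts both chains into the same list. -/
theorem inj_chain {l l' : List B} {x y : C} (hx : Chain (fun b : B => b.1.1) g m l x)
    (hy : Chain (fun b : B => b.1.1) g m l' y) (h : θ.toFun x = θ.toFun y) : x = y := by
  classical
  obtain ⟨s, hs, hsm⟩ := hlf.exists_linearOrder m
  have hswap : ∀ a b x y z, ¬ s a b → Whiskered (fun b : B => b.1.1) g m a x →
      Whiskered (fun b : B => b.1.1) g m b y → IsComp m x y z →
      ∃ x' y', Whiskered (fun b : B => b.1.1) g m b x' ∧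
        Whiskered (fun b : B => b.1.1) g m a y' ∧ IsComp m x' y' z :=
    fun a b x y z hab hx hy hz => H.swap a b x y z
      (hsm a b hx.lt hy.lt ((total_of s a b).resolve_left hab)) hx hy hz
  have hperm : l.Perm l' := hB.perm_of_atomSum_eq hx.lt hy.lt fun j hj => by
    rw [← hg.map_chain_apply hx hj, ← hg.map_chain_apply hy hj, h]
  have e : l.insertionSort s = l'.insertionSort s :=
    (((List.perm_insertionSort s l).trans hperm).trans
      (List.perm_insertionSort s l').symm).eq_of_pairwise' (List.pairwise_insertionSort s l)
      (List.pairwise_insertionSort s l')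
  have hx' := hx.insertionSort s hswap
  rw [e] at hx'
  exact H.inj_chain_same hg hx' (hy.insertionSort s hswap) h

theorem lift_stratum_succ (u : K.nu) (hu : ∀ β j, m + 1 < j → u.1.1 β j = 0) :
    ∃ x ∈ stratum C (m + 1), θ.toFun x = u := by
  -- With no atoms prescribed, all of u_{m+1} is excess; its two signs agree because u vanishes in
  -- dimension m + 2.
  obtain ⟨l₁, hl₁, l', hl', x, hx, e⟩ := H.exists_chain_lift_succ hlf [] (by simp) u hu
    (u.2.1 .minus (m + 1)) (fun β => by
      have e := u.1.2.2 .minus (m + 1)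
      rw [hu .minus (m + 1 + 1) (by omega), map_zero, sub_eq_zero] at e
      rw [atomSum_nil]
      cases β
      · exact (zero_add _).symm
      · exact e.trans (zero_add _).symm)
  exact ⟨x, hx.mem_stratum hg.gen_mem_stratum m.le_succ
    (fun b hb => hl₁ b (hl'.mem_iff.mp hb)), e⟩

theorem lift_whiskered_succ (b : B) (u : K.nu) (hb : m + 1 < b.1.1)
    (hu : ∀ β j, m + 1 < j → u.1.1 β j = (hB.atom b.1).1 β j) :
    ∃ x, Whiskered (fun b : B => b.1.1) g (m + 1) b x ∧ θ.toFun x = u := by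
  have hsum : hB.atomSum [b] = hB.atom b.1 := by rw [atomSum_cons, atomSum_nil, add_zero]
  -- The excess of u over ⟨b⟩ in dimension m + 1 is positive, since by loop-freeness the source and
  -- target of ⟨b⟩ there are disjoint.
  have hs := hB.sub_atom_mem_star (m := m + 1) u.2 (l := [b]) (a := b) (by simp)
    (by rw [hsum]; exact hu _ _ (by omega)) (by simpa using hlf.meet_self hb)
  obtain ⟨l₁, hl₁, l', hl', x, hx, e⟩ := H.exists_chain_lift_succ hlf [b]
    (by simp; omega) u (by rw [hsum]; exact hu) hs (fun β => by
      rw [hsum]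
      cases β
      · abel
      · have e₁ := u.1.2.2 .minus (m + 1)
        have e₂ := (hB.atom b.1).2.2 .minus (m + 1)
        rw [hu .minus (m + 1 + 1) (by omega), ← e₂, sub_eq_iff_eq_add] at e₁
        rw [e₁]
        abel)
  obtain ⟨s, t, rfl⟩ := List.append_of_mem (hl'.mem_iff.mpr (by simp : b ∈ [b] ++ l₁))
  have hst : (s ++ t).Perm l₁ := (List.perm_middle.symm.trans hl').cons_inv
  exact ⟨x, hx.whiskered hg.gen_mem_stratum hb
    (fun a ha => hl₁ a (hst.mem_iff.mp (List.mem_append_left _ ha)))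
    (fun a ha => hl₁ a (hst.mem_iff.mp (List.mem_append_right _ ha))), e⟩

theorem inj_stratum_succ (x y : C) (hx : x ∈ stratum C (m + 1)) (hy : y ∈ stratum C (m + 1))
    (h : θ.toFun x = θ.toFun y) : x = y := by
  obtain ⟨l, hl⟩ := exists_chain_of_mem_stratum hg.stratum_eq hg.gen_mem_stratum hx
  obtain ⟨l', hl'⟩ := exists_chain_of_mem_stratum hg.stratum_eq hg.gen_mem_stratum hy
  exact H.inj_chain hg hlf hl hl' h

theorem inj_whiskered_succ (b : B) (x y : C) (hx : Whiskered (fun b : B => b.1.1) g (m + 1) b x)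
    (hy : Whiskered (fun b : B => b.1.1) g (m + 1) b y) (h : θ.toFun x = θ.toFun y) : x = y := by
  obtain ⟨l, hl⟩ := hx.exists_chain hg.stratum_eq hg.gen_mem_stratum
  obtain ⟨l', hl'⟩ := hy.exists_chain hg.stratum_eq hg.gen_mem_stratum
  exact H.inj_chain hg hlf hl hl' h

/-- The first factors share the (m + 1)-source of the common image and the second factors its (m +
1)-target, so injectivity on whiskered generators applies to each. -/
theorem eq_of_isComp {a b : B} {x y z x' y' z' : C}
    (hx : Whiskered (fun b : B => b.1.1) g (m + 1) a x)
    (hx' : Whiskered (fun b : B => b.1.1) g (m + 1) a x')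
    (hy : Whiskered (fun b : B => b.1.1) g (m + 1) b y)
    (hy' : Whiskered (fun b : B => b.1.1) g (m + 1) b y') (h : IsComp (m + 1) x y z)
    (h' : IsComp (m + 1) x' y' z') (e : θ.toFun z' = θ.toFun z) : z' = z := by
  obtain rfl := H.inj_whiskered_succ hg hlf a x x' hx hx' (hg.map_eq_of_whiskered hx hx' .minus (by
    rw [← θ.coe_map_d, ← θ.coe_map_d, ← h.d_minus, ← h'.d_minus, θ.map_d, θ.map_d, e]))
  obtain rfl := H.inj_whiskered_succ hg hlf b y y' hy hy' (hg.map_eq_of_whiskered hy hy' .plus (by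
    rw [← θ.coe_map_d, ← θ.coe_map_d, ← h.d_plus, ← h'.d_plus, θ.map_d, θ.map_d, e]))
  exact h'.unique h

/-- Disjointness of ⟨a⟩^+ and ⟨b⟩^- lets both atoms be attached to the (m + 1)-source of z
independently. A level-m chain lifting the image of z then separates a from b, and interchange gives
both orders. -/
theorem swap_succ (a b : B) (x y z : C)
    (hab : hB.meet (m + 1) ((hB.atom a.1).1 .plus (m + 1)) ((hB.atom b.1).1 .minus (m + 1)) = 0)
    (hx : Whiskered (fun b : B => b.1.1) g (m + 1) a x)
    (hy : Whiskered (fun b : B => b.1.1) g (m + 1) b y) (h : IsComp (m + 1) x y z) :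
    ∃ x' y', Whiskered (fun b : B => b.1.1) g (m + 1) b x' ∧
      Whiskered (fun b : B => b.1.1) g (m + 1) a y' ∧ IsComp (m + 1) x' y' z := by
  have hsum : hB.atomSum [a, b] = hB.atom a.1 + hB.atom b.1 := by
    rw [atomSum_cons, atomSum_cons, atomSum_nil, add_zero]
  have hxy : (θ.toFun x).1.1 .plus (m + 1) = (θ.toFun y).1.1 .minus (m + 1) := by
    have e := congrArg (fun w => (θ.toFun w).1.1 .plus (m + 1)) h.match
    simpa [θ.coe_map_d, mu.d_apply] using e
  have hz : ∀ β, (θ.toFun z).1.1 β (m + 1) = (θ.toFun x).1.1 β (m + 1) -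
      (θ.toFun x).1.1 .plus (m + 1) + (θ.toFun y).1.1 β (m + 1) := fun β => by
    rw [θ.coe_map_isComp h]
    simp [mu.d_apply]
  have ex : (θ.toFun x).1.1 .plus (m + 1) - (θ.toFun x).1.1 .minus (m + 1) =
      (hB.atom a.1).1 .plus (m + 1) - (hB.atom a.1).1 .minus (m + 1) := by
    rw [(θ.toFun x).1.2.2 .plus, (hB.atom a.1).2.2 .plus, hg.map_whiskered_apply hx (by omega)]
  have ey : (θ.toFun y).1.1 .plus (m + 1) - (θ.toFun y).1.1 .minus (m + 1) =
      (hB.atom b.1).1 .plus (m + 1) - (hB.atom b.1).1 .minus (m + 1) := by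
    rw [(θ.toFun y).1.2.2 .plus, (hB.atom b.1).2.2 .plus, hg.map_whiskered_apply hy (by omega)]
  have hxs := hB.sub_atom_mem_star (m := m + 1) (θ.toFun x).2 (l := [a]) (a := a) (by simp)
    (by rw [atomSum_cons, atomSum_nil, add_zero]; exact hg.map_whiskered_apply hx (by omega) _)
    (by simpa using hlf.meet_self hx.lt)
  have hys := hB.sub_atom_mem_star (m := m + 1) (θ.toFun y).2 (l := [b]) (a := b) (by simp)
    (by rw [atomSum_cons, atomSum_nil, add_zero]; exact hg.map_whiskered_apply hy (by omega) _)
    (by simpa using hlf.meet_self hy.lt)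
  -- In dimension m + 1, the target of x is (x^- - ⟨a⟩^-) + ⟨a⟩^+ and contains ⟨b⟩^-. As ⟨b⟩^-
  -- misses ⟨a⟩^+, it lies in x^- - ⟨a⟩^-.
  have hs := hB.sub_mem_star (hB.atom_apply_mem_star a.2 .plus (m + 1)) hxs
    (hB.atom_apply_mem_star b.2 .minus (m + 1)) (by
      convert hys using 1
      rw [← hxy, sub_left_inj]
      rw [sub_eq_iff_eq_add] at ex
      rw [ex]
      abel) hab
  obtain ⟨l₁, hl₁, l', hl', w, hw, e⟩ := H.exists_chain_lift_succ hlf [a, b]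
    (by have h₁ := hx.lt; have h₂ := hy.lt; simp; omega) (θ.toFun z)
    (fun β j hj => by
      rw [hsum, θ.map_isComp_apply h hj, hg.map_whiskered_apply hx hj,
        hg.map_whiskered_apply hy hj]
      rfl) hs
    (fun β => by
      rw [hsum, hz, AddSubgroup.coe_add, Pi.add_apply, Pi.add_apply]
      rw [sub_eq_iff_eq_add] at ex ey
      cases β
      · rw [← hxy]
        abel
      · rw [ey, ← hxy, ex]
        abel)
  obtain ⟨s, t, rfl⟩ := List.append_of_mem (hl'.mem_iff.mpr (by simp : a ∈ [a, b] ++ l₁))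
  have hst : (s ++ t).Perm (b :: l₁) := (List.perm_middle.symm.trans hl').cons_inv
  -- In the lifted chain b comes either before or after a; either way, cutting just before the later
  -- of the two leaves one in each #_m-factor.
  rcases List.mem_append.mp (hst.mem_iff.mpr List.mem_cons_self) with hb | hb
  · obtain ⟨p, q, rfl⟩ := List.append_of_mem hb
    have hpq : (p ++ (q ++ t)).Perm l₁ := by
      rw [List.append_assoc, List.cons_append] at hst
      exact (List.perm_middle.symm.trans hst).cons_inv
    obtain ⟨B', A, hB', hA, hBA⟩ := hw.exists_of_append
    replace hB' := hB'.whiskered hg.gen_mem_stratum hy.lt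
      (fun c hc => hl₁ c (hpq.mem_iff.mp (by simp [hc])))
      (fun c hc => hl₁ c (hpq.mem_iff.mp (by simp [hc])))
    replace hA := Chain.whiskered hg.gen_mem_stratum (l := []) hA hx.lt (by simp)
      (fun c hc => hl₁ c (hpq.mem_iff.mp (by simp [hc])))
    obtain ⟨x₁, y₁, hx₁, hy₁, h₁⟩ := hBA.eq_whiskers' m.lt_succ_self
    obtain ⟨x₂, y₂, hx₂, hy₂, h₂⟩ := hBA.eq_whiskers m.lt_succ_self
    -- The form with a first has the image of z = x #_{m+1} y, hence equals z; the form with b first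
    -- is the required exchange.
    obtain rfl := H.eq_of_isComp hg hlf hx (.left m.lt_succ_self (d_mem_stratum _ _ _) hA hx₁) hy
      (.right m.lt_succ_self hB' (d_mem_stratum _ _ _) hy₁) h h₁ e
    exact ⟨x₂, y₂, .right m.lt_succ_self hB' (d_mem_stratum _ _ _) hx₂,
      .left m.lt_succ_self (d_mem_stratum _ _ _) hA hy₂, h₂⟩
  · obtain ⟨p, q, rfl⟩ := List.append_of_mem hb
    have hpq : (s ++ p ++ q).Perm l₁ := by
      rw [← List.append_assoc] at hst
      exact (List.perm_middle.symm.trans hst).cons_inv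
    have hw' : Chain (fun b : B => b.1.1) g m ((s ++ a :: p) ++ b :: q) w := by simpa using hw
    obtain ⟨A, B', hA, hB', hAB⟩ := hw'.exists_of_append
    replace hA := hA.whiskered hg.gen_mem_stratum hx.lt
      (fun c hc => hl₁ c (hpq.mem_iff.mp (by simp [hc])))
      (fun c hc => hl₁ c (hpq.mem_iff.mp (by simp [hc])))
    replace hB' := Chain.whiskered hg.gen_mem_stratum (l := []) hB' hy.lt (by simp)
      (fun c hc => hl₁ c (hpq.mem_iff.mp (by simp [hc])))
    obtain ⟨x₁, y₁, hx₁, hy₁, h₁⟩ := hAB.eq_whiskers m.lt_succ_self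
    obtain ⟨x₂, y₂, hx₂, hy₂, h₂⟩ := hAB.eq_whiskers' m.lt_succ_self
    obtain rfl := H.eq_of_isComp hg hlf hx (.right m.lt_succ_self hA (d_mem_stratum _ _ _) hx₁) hy
      (.left m.lt_succ_self (d_mem_stratum _ _ _) hB' hy₁) h h₁ e
    exact ⟨x₂, y₂, .left m.lt_succ_self (d_mem_stratum _ _ _) hB' hx₂,
      .right m.lt_succ_self hA (d_mem_stratum _ _ _) hy₂, h₂⟩

theorem succ : LevelBijective hB θ g (m + 1) where
  inj_stratum := H.inj_stratum_succ hg hlf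
  inj_whiskered := H.inj_whiskered_succ hg hlf
  lift_stratum := H.lift_stratum_succ hg hlf
  lift_whiskered := H.lift_whiskered_succ hg hlf
  swap := H.swap_succ hg hlf

end LevelBijective

/-! ### Level 0 and the resulting bijectivity. -/

section Zero

variable {hB : K.IsBasis B} {θ : OmegaHom C K.nu} {g : B → C}

theorem AugDirComplex.IsBasis.Unital.aug_atomSum (hu : hB.Unital) (l : List B) (α : Side) :
    K.aug ((hB.atomSum l).1 α 0) = l.length := by
  induction l with
  | nil => simp [atomSum_nil]
  | cons b l ih =>
    rw [atomSum_cons, AddSubgroup.coe_add, Pi.add_apply, Pi.add_apply, map_add, ih, hu b.1 b.2]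
    push_cast [List.length_cons]
    ring

/-- On sums of 0-dimensional atoms the augmentation counts summands. -/
theorem AugDirComplex.IsBasis.Unital.eq_zero_of_aug (hu : hB.Unital) {x : K.X 0}
    (hx : x ∈ K.star 0) (h : K.aug x = 0) : x = 0 := by
  obtain ⟨l, _, rfl⟩ : ∃ l : List B, True ∧ (hB.atomSum l).1 .minus 0 = x := by
    obtain ⟨l, _, e⟩ := hB.exists_atomSum hx
    exact ⟨l, trivial, e _⟩
  rw [hu.aug_atomSum] at h
  obtain rfl : l = [] := List.length_eq_zero_iff.mp (by exact_mod_cast h)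
  rfl

theorem IsGeneratorLift.levelBijective_zero (hg : IsGeneratorLift hB θ g) (hu : hB.Unital)
    (hlf : hB.LoopFree) : LevelBijective hB θ g 0 where
  inj_stratum x y hx hy h := by
    obtain ⟨⟨⟨n, b⟩, hb⟩, hn, rfl⟩ :=
      exists_eq_gen_of_mem_stratum_zero hg.stratum_eq hg.gen_mem_stratum hx
    obtain ⟨⟨⟨k, c⟩, hc⟩, hk, rfl⟩ :=
      exists_eq_gen_of_mem_stratum_zero hg.stratum_eq hg.gen_mem_stratum hy
    obtain rfl : n = 0 := hn
    obtain rfl : k = 0 := hk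
    have e := congrArg (fun w => w.1.1 .minus 0) h
    simp only [hg.map_gen] at e
    obtain rfl : b = c := e
    rfl
  inj_whiskered b x y hx hy _ := hx.eq_gen.trans hy.eq_gen.symm
  lift_stratum u h := by
    obtain ⟨l, hl, e⟩ := hB.exists_atomSum (u.2.1 .minus 0)
    have hlen : l.length = 1 := by
      have e' := u.2.2 .minus
      rw [← e .minus, hu.aug_atomSum] at e'
      exact_mod_cast e'
    obtain ⟨b, rfl⟩ := List.length_eq_one_iff.mp hlen
    have hb : b.1.1 = 0 := hl b (by simp)
    rw [atomSum_cons, atomSum_nil, add_zero] at e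
    refine ⟨g b, hb ▸ hg.gen_mem_stratum b, Subtype.ext ?_⟩
    rw [hg.map_gen]
    refine mu.ext_of_d (m := 0) .minus (fun β j hj => ?_) ?_
    · rw [h β j hj, hB.atom_apply_of_gt _ _ (hb ▸ hj)]
    · ext β j
      simp only [mu.d_apply]
      split_ifs with h₁ h₂
      · omega
      · subst h₂; exact e _
      · rfl
  lift_whiskered b u hb h := by
    refine ⟨g b, .gen hb, Subtype.ext ?_⟩
    rw [hg.map_gen]
    have hs := hB.sub_atom_mem_star (m := 0) u.2 (l := [b]) (a := b) (by simp)
      (by rw [atomSum_cons, atomSum_nil, add_zero]; exact h _ _ (by omega))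
      (by simpa using hlf.meet_self hb)
    -- Both 0-sources have augmentation 1, so their positive difference has augmentation 0 and
    -- vanishes.
    have e := hu.eq_zero_of_aug hs (by rw [map_sub, u.2.2, hu b.1 b.2, sub_self])
    refine mu.ext_of_d (m := 0) .minus (fun β j hj => (h β j hj).symm) ?_
    ext β j
    simp only [mu.d_apply]
    split_ifs with h₁ h₂
    · omega
    · subst h₂; exact (sub_eq_zero.mp e).symm
    · rfl
  swap a b x y z hab hx hy h := by
    -- At level 0 composability forces ⟨a⟩^+_0 = ⟨b⟩^-_0. Their meet is then ⟨a⟩^+_0, nonzero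
    -- because its augmentation is 1.
    exfalso
    obtain rfl := hx.eq_gen
    obtain rfl := hy.eq_gen
    have e := congrArg (fun w => (θ.toFun w).1.1 .plus 0) h.match
    simp only [θ.coe_map_d, hg.map_gen, mu.d_apply, lt_irrefl, if_false, if_true] at e
    rw [← e, hB.meet_eq_zero_iff (hB.atom_apply_mem_star a.2 _ _)
      (hB.atom_apply_mem_star a.2 _ _)] at hab
    have h₀ : (hB.atom a.1).1 .plus 0 = 0 :=
      (LinearEquiv.map_eq_zero_iff _).mp (Finsupp.ext fun c => (or_self_iff.mp (hab c)))
    have h₁ := hu a.1 a.2 .plus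
    rw [h₀, map_zero] at h₁
    exact zero_ne_one h₁

theorem IsGeneratorLift.levelBijective (hg : IsGeneratorLift hB θ g) (hu : hB.Unital)
    (hlf : hB.LoopFree) (m : ℕ) : LevelBijective hB θ g m := by
  induction m with
  | zero => exact hg.levelBijective_zero hu hlf
  | succ m ih => exact ih.succ hg hlf

theorem IsGeneratorLift.bijective (hg : IsGeneratorLift hB θ g) (hu : hB.Unital)
    (hlf : hB.LoopFree) : Function.Bijective θ.toFun := by
  constructor
  · intro x y h
    obtain ⟨n, hx⟩ := exists_mem_stratum x
    obtain ⟨k, hy⟩ := exists_mem_stratum y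
    exact (hg.levelBijective hu hlf (max n k)).inj_stratum x y (stratum_mono (le_max_left _ _) hx)
      (stratum_mono (le_max_right _ _) hy) h
  · intro u
    obtain ⟨N, hN⟩ := u.1.2.1
    obtain ⟨x, _, e⟩ := (hg.levelBijective hu hlf N).lift_stratum u fun β j hj => hN j hj.le β
    exact ⟨x, e⟩

end Zero

end Lift

/-! ### From bijectivity to isomorphism, and the theorem. -/

theorem OmegaHom.isIso_of_bijective {C : Type u} {D : Type w} [OmegaCategory C] [OmegaCategory D]
    (f : OmegaHom C D) (h : Function.Bijective f.toFun) : f.IsIso := by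
  let e := Equiv.ofBijective f.toFun h
  have he : ∀ y, f.toFun (e.symm y) = y := e.apply_symm_apply
  have hd : ∀ α n y, e.symm (d α n y) = d α n (e.symm y) := fun α n y =>
    h.1 (by rw [he, f.map_d, he])
  refine ⟨⟨e.symm, hd, fun n x y hxy => h.1 ?_⟩, e.symm_apply_apply, he⟩
  rw [he, f.map_comp]
  congr 1 <;> exact (he _).symm

end Steiner

open Steiner
theorem theorem5p7 {C : Type u} [OmegaCategory C] (E : Set C) (dim : E → ℕ)
    (hE : OmegaCategory.CompositionGenerated E dim)
    (K : AugDirComplex.{v}) (B : Set (Σ n, K.X n)) (hB : K.IsBasis B)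
    (hunital : hB.Unital) (hloopfree : hB.LoopFree)
    (θ : OmegaHom C K.nu)
    (hbij : Set.BijOn θ.toFun E hB.nuAtoms)
    (hdim : ∀ (e : E) (b : Σ n, K.X n), b ∈ B →
      (θ.toFun e : K.mu) = hB.atom b → dim e = b.1) :
    θ.IsIso := by
  have hex : ∀ b : B, ∃ e ∈ E, (θ.toFun e).1 = hB.atom b.1 := fun b => by
    obtain ⟨e, he, h⟩ := hbij.surjOn
      (show (⟨hB.atom b.1, hB.atom_mem_nu hunital b.2⟩ : K.nu) ∈ hB.nuAtoms from ⟨b.1, b.2, rfl⟩)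
    exact ⟨e, he, congrArg Subtype.val h⟩
  choose g hgE hg using hex
  refine θ.isIso_of_bijective (IsGeneratorLift.bijective (hB := hB) (g := g) ⟨hg, fun n => ?_⟩
    hunital hloopfree)
  -- Preservation of dimension makes generation by E, filtered by `dim`, the same as generation by
  -- the family g, filtered by the dimension of basis elements.
  have hset : {e : C | ∃ he : e ∈ E, dim ⟨e, he⟩ ≤ n} = {x | ∃ b : B, b.1.1 ≤ n ∧ x = g b} := by
    ext x
    constructor
    · rintro ⟨hx, hn⟩
      obtain ⟨b, hb, e⟩ := hbij.mapsTo hx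
      refine ⟨⟨b, hb⟩, hdim ⟨x, hx⟩ b hb e ▸ hn, ?_⟩
      exact hbij.injOn hx (hgE _) (Subtype.ext (e.trans (hg ⟨b, hb⟩).symm))
    · rintro ⟨b, hn, rfl⟩
      exact ⟨hgE b, (hdim ⟨g b, hgE b⟩ b.1 b.2 (hg b)).trans_le hn⟩
  rw [hE n, hset]
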